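/- Let $M$ be a smooth surface and let $\mathcal A\subset TM\setminus 0$ be a conic subbundle, i.e. an open set, invariant under multiplication of vectors by positive reals, with $\pi(\mathcal A)=M$. Let $F:\mathcal A\to\mathbb R$ be a conic pseudo-Finsler metric: a smooth function, positively homogeneous of degree $1$ in $y$, whose metric tensor $g_{ij}=\frac12\dot\partial_i\dot\partial_jF^2$ is nondegenerate (here $\partial_i=\partial/\partial x^i$, $\dot\partial_i=\partial/\partial y^i$). Attach to $F$, in natural coordinates $(x^i,y^i)$ of $TM$: * the sign $\varepsilon=\pm1$ of $\det(g_{ij})$, and the modified Berwald frame $\ell_i=\dot\partial_iF$, $\ell^i=y^i/F$, $(m_1,m_2)=\sqrt{\varepsilon\det g}\,(-\ell^2,\ell^1)$, $(m^1,m^2)=\frac{\varepsilon}{\sqrt{\varepsilon\det g}}(-\ell_2,\ell_1)$; * the geodesic spray $S=y^i\partial_i-2G^i\dot\partial_i$, $G^i=\frac14g^{il}(y^r\partial_r\dot\partial_lF^2-\partial_lF^2)$, the horizontal derivatives $\delta_i=\partial_i-(\dot\partial_iG^j)\dot\partial_j$, and the Berwald curvature $G^h_{ijk}=\dot\partial_k\dot\partial_i\dot\partial_jG^h$;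 * the main scalar $\mathcal I$, defined by $F\cdot\frac14\dot\partial_i\dot\partial_j\dot\partial_kF^2=\mathcal I\,m_im_jm_k$, and the Landsberg scalar $\mathcal J=S(\mathcal I)$; * for a function $f$ on $\mathcal A$, the scalar derivatives $f_{;2}=\varepsilon F(\dot\partial_if)m^i$, $f_{,1}=(\delta_if)\ell^i$, $f_{,2}=\varepsilon(\delta_if)m^i$. The metric $F$ is Landsberg if $\mathcal J=0$ on $\mathcal A$, and Berwald if $G^h_{ijk}=0$ on $\mathcal A$. Let $\overline F=e^{\phi}F$ be an anisotropic conformal change of $F$: $\phi$ is a smooth function on $\mathcal A$, positively homogeneous of degree $0$ in $y$, with $F^2\big(\dot\partial_i\dot\partial_j\phi+(\dot\partial_i\phi)(\dot\partial_j\phi)\big)m^im^j+\varepsilon\neq0$ on $\mathcal A$. Put $$q=\phi_{;2}\,\phi_{,1}+\phi_{,1;2}-2\phi_{,2}$$ (scalar derivatives with respect to $F$), and let $Q,P$ be the functions with $\overline G^i=G^i+Qm^i+P\ell^i$, where $\overline G^i$ are the spray coefficients of $\overline F$. **Theorem.** Suppose that the main scalar $\overline{\mathcal I}$ of $\overline F$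 is a first integral of the geodesic spray $S$ of $F$, i.e. $S(\overline{\mathcal I})=0$ on $\mathcal A$. Then: 1. At each point of $\mathcal A$, $q=0$ if and only if $Q=0$. 2. $\overline F$ is Landsberg if and only if at every point of $\mathcal A$ either $q=0$ or the Berwald curvature of $\overline F$ vanishes. 3. If $q=0$ on all of $\mathcal A$, or if $\overline F$ is Berwald, then $\overline F$ is Landsberg. 4. If $q$ either vanishes identically on $\mathcal A$ or vanishes identically on no nonempty open subset of $\mathcal A$, then $\overline F$ is Landsberg if and only if either $q=0$ identically on $\mathcal A$ or $\overline F$ is Berwald. -/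

import Mathlib

open Set
open scoped Manifold ContDiff

noncomputable section

namespace FinslerSurface

/-- The coordinate plane `ℝ²`. -/
abbrev Plane : Type := EuclideanSpace ℝ (Fin 2)

/-! ### Finsler geometry in coordinates

A point `z : Plane × Plane` is `(x, y) = (x¹, x²; y¹, y²)`.  All objects below are attached to a
function `F (x, y)` and are used only on the open set where `F` is a conic pseudo-Finsler metric. -/

/-- `∂ᵢ f`, the derivative in the position `xⁱ`. -/
def dx (i : Fin 2) (f : Plane × Plane → ℝ) : Plane × Plane → ℝ :=
  fun z => fderiv ℝ f z (EuclideanSpace.single i 1, 0)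

/-- `∂̇ᵢ f`, the derivative in the direction `yⁱ`. -/
def dy (i : Fin 2) (f : Plane × Plane → ℝ) : Plane × Plane → ℝ :=
  fun z => fderiv ℝ f z (0, EuclideanSpace.single i 1)

/-- The metric tensor `gᵢⱼ = ½ ∂̇ᵢ ∂̇ⱼ F²`. -/
def metric (F : Plane × Plane → ℝ) (z : Plane × Plane) : Matrix (Fin 2) (Fin 2) ℝ :=
  Matrix.of fun i j => (1 / 2 : ℝ) * dy i (dy j fun w => F w ^ 2) z

/-- The determinant of the metric tensor. -/
def metricDet (F : Plane × Plane → ℝ) (z : Plane × Plane) : ℝ := (metric F z).det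

/-- The signature `ε = ±1` of a nondegenerate metric: the sign of `det (gᵢⱼ)`. -/
def sig (F : Plane × Plane → ℝ) (z : Plane × Plane) : ℝ := Real.sign (metricDet F z)

/-- The coefficients of the geodesic spray,
`Gⁱ = ¼ gⁱˡ (yʳ ∂ᵣ ∂̇ₗ F² - ∂ₗ F²)`. -/
def sprayCoeff (F : Plane × Plane → ℝ) (i : Fin 2) : Plane × Plane → ℝ :=
  fun z => (1 / 4 : ℝ) * ∑ l, (metric F z)⁻¹ i l *
    ((∑ r, z.2 r * dx r (dy l fun w => F w ^ 2) z) - dx l (fun w => F w ^ 2) z)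

/-- The geodesic spray `S = yⁱ ∂ᵢ - 2 Gⁱ ∂̇ᵢ` of `F`, acting on functions. -/
def spray (F f : Plane × Plane → ℝ) : Plane × Plane → ℝ :=
  fun z => (∑ i, z.2 i * dx i f z) - 2 * ∑ i, sprayCoeff F i z * dy i f z

/-- The Barthel connection `Gⁱⱼ = ∂̇ⱼ Gⁱ`. -/
def barthel (F : Plane × Plane → ℝ) (i j : Fin 2) : Plane × Plane → ℝ :=
  dy j (sprayCoeff F i)

/-- The Berwald connection `Gʰᵢⱼ = ∂̇ᵢ Gʰⱼ`. -/
def berwaldConn (F : Plane × Plane → ℝ) (h i j : Fin 2) : Plane × Plane → ℝ :=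
  dy i (barthel F h j)

/-- The Berwald curvature `Gʰᵢⱼₖ = ∂̇ₖ Gʰᵢⱼ`. -/
def berwaldCurv (F : Plane × Plane → ℝ) (h i j k : Fin 2) : Plane × Plane → ℝ :=
  dy k (berwaldConn F h i j)

/-- The horizontal derivative `δᵢ f = ∂ᵢ f - Gʲᵢ ∂̇ⱼ f`. -/
def hderiv (F : Plane × Plane → ℝ) (i : Fin 2) (f : Plane × Plane → ℝ) : Plane × Plane → ℝ :=
  fun z => dx i f z - ∑ j, barthel F j i z * dy j f z

/-- `ℓᵢ = ∂̇ᵢ F`. -/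
def ellLow (F : Plane × Plane → ℝ) (i : Fin 2) : Plane × Plane → ℝ := dy i F

/-- `ℓⁱ = yⁱ / F`. -/
def ellUp (F : Plane × Plane → ℝ) (i : Fin 2) : Plane × Plane → ℝ := fun z => z.2 i / F z

/-- `(m₁, m₂) = √(ε det g) (-ℓ², ℓ¹)`. -/
def mLow (F : Plane × Plane → ℝ) (i : Fin 2) : Plane × Plane → ℝ :=
  fun z => Real.sqrt (sig F z * metricDet F z) * (![-ellUp F 1 z, ellUp F 0 z] : Fin 2 → ℝ) i

/-- `(m¹, m²) = ε / √(ε det g) (-ℓ₂, ℓ₁)`. -/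
def mUp (F : Plane × Plane → ℝ) (i : Fin 2) : Plane × Plane → ℝ :=
  fun z => sig F z / Real.sqrt (sig F z * metricDet F z) *
    (![-ellLow F 1 z, ellLow F 0 z] : Fin 2 → ℝ) i

/-- The Cartan tensor `Cᵢⱼₖ = ¼ ∂̇ᵢ ∂̇ⱼ ∂̇ₖ F²`. -/
def cartan (F : Plane × Plane → ℝ) (i j k : Fin 2) : Plane × Plane → ℝ :=
  fun z => (1 / 4 : ℝ) * dy i (dy j (dy k fun w => F w ^ 2)) z

/-- The main scalar `I`, determined by `F Cᵢⱼₖ = I mᵢ mⱼ mₖ`; since `mⁱ mᵢ = ε`, contracting this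
equation with `mⁱ mʲ mᵏ` gives `I = ε F Cᵢⱼₖ mⁱ mʲ mᵏ`. -/
def mainScalar (F : Plane × Plane → ℝ) : Plane × Plane → ℝ :=
  fun z => sig F z * F z *
    ∑ i, ∑ j, ∑ k, cartan F i j k z * mUp F i z * mUp F j z * mUp F k z

/-- The Landsberg scalar `J = S(I)`. -/
def landsbergScalar (F : Plane × Plane → ℝ) : Plane × Plane → ℝ := spray F (mainScalar F)

/-- The v-scalar derivative `f_{;2} = ε F (∂̇ᵢ f) mⁱ`. -/
def vder2 (F f : Plane × Plane → ℝ) : Plane × Plane → ℝ :=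
  fun z => sig F z * F z * ∑ i, dy i f z * mUp F i z

/-- The h-scalar derivative `f_{,1} = (δᵢ f) ℓⁱ`. -/
def hder1 (F f : Plane × Plane → ℝ) : Plane × Plane → ℝ :=
  fun z => ∑ i, hderiv F i f z * ellUp F i z

/-- The h-scalar derivative `f_{,2} = ε (δᵢ f) mⁱ`. -/
def hder2 (F f : Plane × Plane → ℝ) : Plane × Plane → ℝ :=
  fun z => sig F z * ∑ i, hderiv F i f z * mUp F i z

/-- The expression `φ_{;2} φ_{,1} + φ_{,1;2} - 2 φ_{,2}`, taken with respect to `F`. -/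
def qExpr (F φ : Plane × Plane → ℝ) : Plane × Plane → ℝ :=
  fun z => vder2 F φ z * hder1 F φ z + vder2 F (hder1 F φ) z - 2 * hder2 F φ z

/-- The function `Q` in `Ḡⁱ = Gⁱ + Q mⁱ + P ℓⁱ`, where `Ḡⁱ` are the spray coefficients of `F'`;
as `ℓⁱ mᵢ = 0` and `mⁱ mᵢ = ε`, it is `Q = ε (Ḡⁱ - Gⁱ) mᵢ`. -/
def sprayQ (F F' : Plane × Plane → ℝ) : Plane × Plane → ℝ :=
  fun z => sig F z * ∑ i, (sprayCoeff F' i z - sprayCoeff F i z) * mLow F i z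

/-! ### Conic pseudo-Finsler surfaces -/

section Surface

variable {M : Type*} [TopologicalSpace M] [ChartedSpace Plane M] [IsManifold (𝓡 2) ∞ M]

/-- The natural coordinates `(x, y)` of the tangent bundle induced by the chart of `M` at `p`. -/
def tangentChart (p : M) : PartialEquiv (TangentBundle (𝓡 2) M) (Plane × Plane) :=
  extChartAt (𝓡 2).tangent (⟨p, 0⟩ : TangentBundle (𝓡 2) M)

/-- A function on the tangent bundle, written in the natural coordinates at `p`. -/
def loc (p : M) (f : TangentBundle (𝓡 2) M → ℝ) : Plane × Plane → ℝ :=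
  fun z => f ((tangentChart p).symm z)

/-- The part of `A` inside the chart at `p`, written in the natural coordinates at `p`. -/
def locDom (A : Set (TangentBundle (𝓡 2) M)) (p : M) : Set (Plane × Plane) :=
  {z | z ∈ (tangentChart p).target ∧ (tangentChart p).symm z ∈ A}

/-- Conic subbundles of `TM`: open sets of nonzero tangent vectors that are invariant under
positive scaling and project onto `M`. -/
structure IsConicSubbundle (A : Set (TangentBundle (𝓡 2) M)) : Prop where
  isOpen : IsOpen A
  ne_zero : ∀ u ∈ A, u.2 ≠ 0
  smul_mem : ∀ u ∈ A, ∀ c : ℝ, 0 < c → (⟨u.1, c • u.2⟩ : TangentBundle (𝓡 2) M) ∈ A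
  surj : ∀ x : M, ∃ u ∈ A, u.1 = x

/-- `f` is smooth on `A` and positively homogeneous of degree `r` in the direction, for a natural
number `r`. -/
structure IsSmoothHomogeneous (A : Set (TangentBundle (𝓡 2) M)) (r : ℕ)
    (f : TangentBundle (𝓡 2) M → ℝ) : Prop where
  smooth : ContMDiffOn (𝓡 2).tangent 𝓘(ℝ, ℝ) ∞ f A
  homogeneous : ∀ u ∈ A, ∀ c : ℝ, 0 < c →
    f (⟨u.1, c • u.2⟩ : TangentBundle (𝓡 2) M) = c ^ r * f u

/-- `F : A → ℝ` is a conic pseudo-Finsler metric on `M`. -/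
structure IsConicPseudoFinsler (A : Set (TangentBundle (𝓡 2) M))
    (F : TangentBundle (𝓡 2) M → ℝ) : Prop where
  conic : IsConicSubbundle A
  smoothHomogeneous : IsSmoothHomogeneous A 1 F
  nondegenerate : ∀ p : M, ∀ z ∈ locDom A p, metricDet (loc p F) z ≠ 0

/-- `φ` is the factor of an anisotropic conformal change of `F`: it is a smooth function on `A`,
positively homogeneous of degree `0`, and
`F² (∂̇ᵢ ∂̇ⱼ φ + (∂̇ᵢ φ) (∂̇ⱼ φ)) mⁱ mʲ + ε ≠ 0`. -/
structure IsAnisotropicConformalFactor (A : Set (TangentBundle (𝓡 2) M))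
    (F φ : TangentBundle (𝓡 2) M → ℝ) : Prop where
  smoothHomogeneous : IsSmoothHomogeneous A 0 φ
  nondegenerate : ∀ p : M, ∀ z ∈ locDom A p,
    loc p F z ^ 2 * (∑ i, ∑ j, (dy i (dy j (loc p φ)) z + dy i (loc p φ) z * dy j (loc p φ) z) *
      mUp (loc p F) i z * mUp (loc p F) j z) + sig (loc p F) z ≠ 0

/-- The metric `F̄ = e^φ F`. -/
def anisotropicChange (F φ : TangentBundle (𝓡 2) M → ℝ) : TangentBundle (𝓡 2) M → ℝ :=
  fun u => Real.exp (φ u) * F u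

/-- The main scalar of `F'` is a first integral of the geodesic spray of `F`.  The main scalar is
written in natural coordinates; a change of orientation of the chart only changes its sign. -/
def MainScalarIsFirstIntegral (A : Set (TangentBundle (𝓡 2) M))
    (F F' : TangentBundle (𝓡 2) M → ℝ) : Prop :=
  ∀ p : M, ∀ z ∈ locDom A p, spray (loc p F) (mainScalar (loc p F')) z = 0

/-- `F` is a Landsberg metric: its Landsberg scalar vanishes. -/
def IsLandsberg (A : Set (TangentBundle (𝓡 2) M)) (F : TangentBundle (𝓡 2) M → ℝ) : Prop :=
  ∀ p : M, ∀ z ∈ locDom A p, landsbergScalar (loc p F) z = 0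

/-- The Berwald curvature of `F` vanishes at the point with coordinates `z` in the chart at `p`. -/
def IsBerwaldAt (F : TangentBundle (𝓡 2) M → ℝ) (p : M) (z : Plane × Plane) : Prop :=
  ∀ h i j k : Fin 2, berwaldCurv (loc p F) h i j k z = 0

/-- `F` is Berwaldian: its Berwald curvature vanishes. -/
def IsBerwald (A : Set (TangentBundle (𝓡 2) M)) (F : TangentBundle (𝓡 2) M → ℝ) : Prop :=
  ∀ p : M, ∀ z ∈ locDom A p, IsBerwaldAt F p z

/-- `φ_{;2} φ_{,1} + φ_{,1;2} - 2 φ_{,2} = 0` at the point with coordinates `z` in the chart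
at `p`. -/
def QVanishesAt (F φ : TangentBundle (𝓡 2) M → ℝ) (p : M) (z : Plane × Plane) : Prop :=
  qExpr (loc p F) (loc p φ) z = 0

/-- `φ_{;2} φ_{,1} + φ_{,1;2} - 2 φ_{,2} = 0` identically on `A`. -/
def QVanishes (A : Set (TangentBundle (𝓡 2) M)) (F φ : TangentBundle (𝓡 2) M → ℝ) : Prop :=
  ∀ p : M, ∀ z ∈ locDom A p, QVanishesAt F φ p z

/-- `φ_{;2} φ_{,1} + φ_{,1;2} - 2 φ_{,2}` vanishes identically on no nonempty open subset
of `A`. -/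
def QVanishesOnNoOpenSet (A : Set (TangentBundle (𝓡 2) M))
    (F φ : TangentBundle (𝓡 2) M → ℝ) : Prop :=
  ∀ p : M, interior {z | z ∈ locDom A p ∧ QVanishesAt F φ p z} = ∅

end Surface

end FinslerSurface

end

open FinslerSurface

/-!
The statement is local, so `F` and `F̄ = e^φ F` are treated as functions of natural coordinates
`(x, y)` on an open set. Homogeneity enters only through Euler's identity (`IsHom`). Write
`D = Ḡ - G` for the difference of the spray coefficients, and `y ∧ D` for `y¹D² - y²D¹`.

*`q = 0` exactly where `Q = 0`.* The spray equation of `F̄` reads `S̄(∂̇ₗF̄) = ∂ₗF̄`. Replacing `S̄` by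
`S - 2 Dⁱ∂̇ᵢ` and contracting with `mˡ` gives `2 Dⁱ (∂̇ᵢ∂̇ₗF̄) mˡ = ε e^φ F q`
(`sub_sprayCoeff_hessian`). The Hessian of `F̄` kills `y`, and it is nonzero on `m` by the
nondegeneracy condition on `φ`, so `q`, `Q` and `y ∧ D` have the same zeros (`qExpr_eq_zero_iff`,
`sprayQ_eq_zero_iff`).

*The Landsberg scalar of `F̄`.* Since `S(Ī) = 0`, one has `J̄ = S̄(Ī) = -2 Dⁱ ∂̇ᵢĪ`. As `Ī` is
homogeneous of degree `0`, this vanishes where `D` is a multiple of `y`; conversely, where `J̄ = 0`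
and `D` is not a multiple of `y`, `Ī` has no derivative in `y`.

*Berwald curvature.* Two facts about a single metric remain. The first is that the Landsberg scalar
is a multiple of `(∂̇ₕF²) Gʰᵢⱼₖ mⁱ mʲ mᵏ` (`landsbergScalar_eq`), so it vanishes with the Berwald
curvature. The second is that a Landsberg metric whose main scalar is independent of `y` on an open
set is Berwald there (`berwaldCurv_eq_zero`): the commutator of `S` with `∂̇ₖ` shows that the main
scalar is also independent of `x`; as `δₑ` transports the metric and hence the frame, `δₑ I = 0`
becomes a relation on the remaining component of `Gʰᵢⱼₖ`. Both rest on `fderiv_mainScalar`,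
which computes the derivative of the main scalar in any direction that transports the metric.

The pointwise alternative becomes a global one by continuity of the Berwald curvature.
-/

namespace FinslerSurface

/-! ### Natural coordinates -/

section Charts

variable {M : Type*} [TopologicalSpace M] [ChartedSpace Plane M] [IsManifold (𝓡 2) ∞ M]

/-- The natural coordinates are linear in the direction. -/
theorem tangentChart_symm_smul (p : M) (x y : Plane) (c : ℝ) :
    (tangentChart p).symm (x, c • y) =
      ⟨((tangentChart p).symm (x, y)).1, c • ((tangentChart p).symm (x, y)).2⟩ := by
  have h : ∀ v : Plane, (tangentChart p).symm (x, v) =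
      (⟨(chartAt Plane p).symm x, (tangentBundleCore (𝓡 2) M).coordChange (achart Plane p)
        ((tangentBundleCore (𝓡 2) M).indexAt ((chartAt Plane p).symm x))
        ((chartAt Plane p).symm x) v⟩ : TangentBundle (𝓡 2) M) := fun v => rfl
  rw [h, h, map_smul]
  rfl

theorem isOpen_locDom {A : Set (TangentBundle (𝓡 2) M)} (hA : IsOpen A) (p : M) :
    IsOpen (locDom A p) :=
  (continuousOn_extChartAt_symm (I := (𝓡 2).tangent) (⟨p, 0⟩ : TangentBundle (𝓡 2) M)
    ).isOpen_inter_preimage (isOpen_extChartAt_target _) hA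

theorem contDiffOn_loc {A : Set (TangentBundle (𝓡 2) M)} {f : TangentBundle (𝓡 2) M → ℝ}
    (hf : ContMDiffOn (𝓡 2).tangent 𝓘(ℝ, ℝ) ∞ f A) (p : M) :
    ContDiffOn ℝ ∞ (loc p f) (locDom A p) := by
  have : IsManifold (𝓡 2).tangent ∞ (TangentBundle (𝓡 2) M) := inferInstance
  have h := contMDiffOn_extChartAt_symm (I := (𝓡 2).tangent) (n := ∞)
    (⟨p, 0⟩ : TangentBundle (𝓡 2) M)
  have hs : locDom A p ⊆
      (extChartAt (𝓡 2).tangent (⟨p, 0⟩ : TangentBundle (𝓡 2) M)).target := fun z hz => hz.1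
  have h2 := hf.comp (h.mono hs) fun z hz => hz.2
  rw [← contMDiffOn_iff_contDiffOn]
  exact h2

theorem loc_smul {A : Set (TangentBundle (𝓡 2) M)} {f : TangentBundle (𝓡 2) M → ℝ} {r : ℕ}
    (hf : IsSmoothHomogeneous A r f) (p : M) {z : Plane × Plane} (hz : z ∈ locDom A p) {c : ℝ}
    (hc : 0 < c) : loc p f (z.1, c • z.2) = c ^ r * loc p f z := by
  have := hf.homogeneous _ hz.2 c hc
  unfold loc
  rw [tangentChart_symm_smul]
  exact this

end Charts

/-! ### Directional derivatives and homogeneous functions -/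

/-- `f` is differentiable at `z` and its derivative in the direction `v` is `a`. -/
def HasDirDeriv (f : Plane × Plane → ℝ) (z v : Plane × Plane) (a : ℝ) : Prop :=
  DifferentiableAt ℝ f z ∧ fderiv ℝ f z v = a

namespace HasDirDeriv

variable {f g : Plane × Plane → ℝ} {z v : Plane × Plane} {a b : ℝ}

theorem add (hf : HasDirDeriv f z v a) (hg : HasDirDeriv g z v b) :
    HasDirDeriv (fun w => f w + g w) z v (a + b) :=
  ⟨hf.1.fun_add hg.1, by rw [fderiv_fun_add hf.1 hg.1, ← hf.2, ← hg.2]; rfl⟩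

theorem sub (hf : HasDirDeriv f z v a) (hg : HasDirDeriv g z v b) :
    HasDirDeriv (fun w => f w - g w) z v (a - b) :=
  ⟨hf.1.fun_sub hg.1, by rw [fderiv_fun_sub hf.1 hg.1, ← hf.2, ← hg.2]; rfl⟩

theorem neg (hf : HasDirDeriv f z v a) : HasDirDeriv (fun w => -f w) z v (-a) :=
  ⟨hf.1.fun_neg, by rw [fderiv_fun_neg, ← hf.2]; rfl⟩

theorem mul (hf : HasDirDeriv f z v a) (hg : HasDirDeriv g z v b) :
    HasDirDeriv (fun w => f w * g w) z v (a * g z + f z * b) :=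
  ⟨hf.1.fun_mul hg.1, by
    rw [fderiv_fun_mul hf.1 hg.1, ← hf.2, ← hg.2]
    simp only [add_apply, smul_apply, smul_eq_mul]
    ring⟩

theorem const (c : ℝ) : HasDirDeriv (fun _ => c) z v 0 :=
  ⟨differentiableAt_const c, by rw [fderiv_fun_const]; rfl⟩

theorem const_mul (c : ℝ) (hf : HasDirDeriv f z v a) :
    HasDirDeriv (fun w => c * f w) z v (c * a) :=
  ⟨hf.1.const_mul c, by rw [fderiv_const_mul hf.1, ← hf.2]; rfl⟩

theorem sum {f : Fin 2 → Plane × Plane → ℝ} {a : Fin 2 → ℝ}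
    (hf : ∀ i, HasDirDeriv (f i) z v (a i)) :
    HasDirDeriv (fun w => ∑ i, f i w) z v (∑ i, a i) := by
  simpa only [Fin.sum_univ_two] using (hf 0).add (hf 1)

theorem scomp {h : ℝ → ℝ} {h' : ℝ} (hh : HasDerivAt h h' (f z)) (hf : HasDirDeriv f z v a) :
    HasDirDeriv (fun w => h (f w)) z v (h' * a) := by
  have := hh.comp_hasFDerivAt z hf.1.hasFDerivAt
  refine ⟨this.differentiableAt, ?_⟩
  change fderiv ℝ (h ∘ f) z v = _
  rw [this.fderiv, ← hf.2]
  rfl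

theorem sq (hf : HasDirDeriv f z v a) : HasDirDeriv (fun w => f w ^ 2) z v (2 * f z * a) := by
  simpa using scomp (hasDerivAt_pow 2 (f z)) hf

theorem inv (h0 : f z ≠ 0) (hf : HasDirDeriv f z v a) :
    HasDirDeriv (fun w => (f w)⁻¹) z v (-(f z ^ 2)⁻¹ * a) :=
  scomp (hasDerivAt_inv h0) hf

theorem sqrt (h0 : f z ≠ 0) (hf : HasDirDeriv f z v a) :
    HasDirDeriv (fun w => √(f w)) z v (1 / (2 * √(f z)) * a) :=
  scomp (Real.hasDerivAt_sqrt h0) hf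

theorem exp (hf : HasDirDeriv f z v a) :
    HasDirDeriv (fun w => Real.exp (f w)) z v (Real.exp (f z) * a) :=
  scomp (Real.hasDerivAt_exp (f z)) hf

theorem snd_apply (i : Fin 2) : HasDirDeriv (fun w => w.2 i) z v (v.2 i) := by
  have h : HasFDerivAt (fun w : Plane × Plane => w.2 i)
      ((EuclideanSpace.proj i : Plane →L[ℝ] ℝ).comp (ContinuousLinearMap.snd ℝ Plane Plane)) z :=
    ContinuousLinearMap.hasFDerivAt
      ((EuclideanSpace.proj i : Plane →L[ℝ] ℝ).comp (ContinuousLinearMap.snd ℝ Plane Plane))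
  exact ⟨h.differentiableAt, by rw [h.fderiv]; rfl⟩

/-- Functions that agree on an open set have the same derivatives there. -/
theorem unique {U : Set (Plane × Plane)} (hU : IsOpen U) (hz : z ∈ U) (hfg : EqOn f g U)
    (hf : HasDirDeriv f z v a) (hg : HasDirDeriv g z v b) : a = b := by
  rw [← hf.2, ← hg.2, (hfg.eventuallyEq_of_mem (hU.mem_nhds hz)).fderiv_eq]

end HasDirDeriv

theorem hasDirDeriv_of_contDiffOn {U : Set (Plane × Plane)} (hU : IsOpen U)
    {f : Plane × Plane → ℝ} (hf : ContDiffOn ℝ ∞ f U) {z : Plane × Plane} (hz : z ∈ U)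
    (v : Plane × Plane) : HasDirDeriv f z v (fderiv ℝ f z v) :=
  ⟨(hf.contDiffAt (hU.mem_nhds hz)).differentiableAt (by simp), rfl⟩

theorem contDiffOn_fderiv_apply {U : Set (Plane × Plane)} (hU : IsOpen U)
    {f : Plane × Plane → ℝ} (hf : ContDiffOn ℝ ∞ f U) (v : Plane × Plane) :
    ContDiffOn ℝ ∞ (fun z => fderiv ℝ f z v) U :=
  (hf.fderiv_of_isOpen hU (m := ∞) (by simp)).clm_apply contDiffOn_const

/-- Second derivatives commute. -/
theorem fderiv_fderiv_comm {U : Set (Plane × Plane)} (hU : IsOpen U)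
    {f : Plane × Plane → ℝ} (hf : ContDiffOn ℝ ∞ f U) {z : Plane × Plane} (hz : z ∈ U)
    (v w : Plane × Plane) :
    fderiv ℝ (fun u => fderiv ℝ f u v) z w = fderiv ℝ (fun u => fderiv ℝ f u w) z v := by
  have hfz := hf.contDiffAt (hU.mem_nhds hz)
  have hd : DifferentiableAt ℝ (fderiv ℝ f) z :=
    (hfz.fderiv_right (m := 1) (by exact WithTop.coe_le_coe.2 le_top)).differentiableAt (by simp)
  have hs : IsSymmSndFDerivAt ℝ f z :=
    hfz.isSymmSndFDerivAt (by
      simp only [minSmoothness_of_isRCLikeNormedField]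
      exact WithTop.coe_le_coe.2 le_top)
  have key : ∀ v w : Plane × Plane,
      fderiv ℝ (fun u => fderiv ℝ f u v) z w = fderiv ℝ (fderiv ℝ f) z w v := by
    intro v w
    have := (hd.hasFDerivAt.clm_apply (hasFDerivAt_const v z)).fderiv
    rw [this]
    simp
  rw [key, key, hs.eq]

/-- A derivative is the combination of the partial derivatives `∂ᵢ` and `∂̇ᵢ`. -/
theorem fderiv_apply_eq (f : Plane × Plane → ℝ) (z v : Plane × Plane) :
    fderiv ℝ f z v = v.1 0 * dx 0 f z + v.1 1 * dx 1 f z +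
      (v.2 0 * dy 0 f z + v.2 1 * dy 1 f z) := by
  have hP : ∀ y : Plane, y = y 0 • EuclideanSpace.single (0 : Fin 2) (1 : ℝ) +
      y 1 • EuclideanSpace.single (1 : Fin 2) (1 : ℝ) := by
    intro y
    ext i
    fin_cases i <;> simp
  have hv : v = v.1 0 • ((EuclideanSpace.single 0 1, 0) : Plane × Plane) +
      v.1 1 • ((EuclideanSpace.single 1 1, 0) : Plane × Plane) +
      (v.2 0 • ((0, EuclideanSpace.single 0 1) : Plane × Plane) +
      v.2 1 • ((0, EuclideanSpace.single 1 1) : Plane × Plane)) := by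
    ext1
    · simpa using hP v.1
    · simpa using hP v.2
  conv_lhs => rw [hv]
  simp only [map_add, map_smul, smul_eq_mul]
  rfl

/-- `f` is smooth on `U` and satisfies Euler's identity `yⁱ ∂̇ᵢ f = r f` there: the infinitesimal
form of positive homogeneity of degree `r` in the direction. -/
structure IsHom (U : Set (Plane × Plane)) (r : ℝ) (f : Plane × Plane → ℝ) : Prop where
  smooth : ContDiffOn ℝ ∞ f U
  euler_fderiv : ∀ z ∈ U, fderiv ℝ f z (0, z.2) = r * f z

namespace IsHom

variable {U : Set (Plane × Plane)} {r s : ℝ} {f g : Plane × Plane → ℝ} {z : Plane × Plane}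

theorem euler (hf : IsHom U r f) (hz : z ∈ U) :
    z.2 0 * dy 0 f z + z.2 1 * dy 1 f z = r * f z := by
  rw [← hf.euler_fderiv z hz, fderiv_apply_eq]
  simp

theorem dirDeriv (hU : IsOpen U) (hf : IsHom U r f) (hz : z ∈ U) (v : Plane × Plane) :
    HasDirDeriv f z v (fderiv ℝ f z v) :=
  hasDirDeriv_of_contDiffOn hU hf.smooth hz v

theorem dx' (hU : IsOpen U) (hf : IsHom U r f) (hz : z ∈ U) (i : Fin 2) :
    HasDirDeriv f z (EuclideanSpace.single i 1, 0) (dx i f z) := hf.dirDeriv hU hz _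

theorem dy' (hU : IsOpen U) (hf : IsHom U r f) (hz : z ∈ U) (i : Fin 2) :
    HasDirDeriv f z (0, EuclideanSpace.single i 1) (dy i f z) := hf.dirDeriv hU hz _

theorem of_hasDirDeriv (hs : ContDiffOn ℝ ∞ f U)
    (h : ∀ z ∈ U, HasDirDeriv f z (0, z.2) (r * f z)) : IsHom U r f :=
  ⟨hs, fun z hz => (h z hz).2⟩

theorem radial (hU : IsOpen U) (hf : IsHom U r f) (hz : z ∈ U) :
    HasDirDeriv f z (0, z.2) (r * f z) :=
  hf.euler_fderiv z hz ▸ hf.dirDeriv hU hz _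

theorem mono {V : Set (Plane × Plane)} (hf : IsHom U r f) (h : V ⊆ U) : IsHom V r f :=
  ⟨hf.smooth.mono h, fun z hz => hf.euler_fderiv z (h hz)⟩

theorem cast (hf : IsHom U r f) (h : r = s) : IsHom U s f := h ▸ hf

theorem add (hU : IsOpen U) (hf : IsHom U r f) (hg : IsHom U r g) :
    IsHom U r (fun w => f w + g w) :=
  of_hasDirDeriv (hf.smooth.add hg.smooth) fun z hz => by
    convert (hf.radial hU hz).add (hg.radial hU hz) using 1
    ring

theorem sub (hU : IsOpen U) (hf : IsHom U r f) (hg : IsHom U r g) :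
    IsHom U r (fun w => f w - g w) :=
  of_hasDirDeriv (hf.smooth.sub hg.smooth) fun z hz => by
    convert (hf.radial hU hz).sub (hg.radial hU hz) using 1
    ring

theorem mul (hU : IsOpen U) (hf : IsHom U r f) (hg : IsHom U s g) :
    IsHom U (r + s) (fun w => f w * g w) :=
  of_hasDirDeriv (hf.smooth.mul hg.smooth) fun z hz => by
    convert (hf.radial hU hz).mul (hg.radial hU hz) using 1
    ring

theorem const (c : ℝ) : IsHom U 0 (fun _ => c) :=
  of_hasDirDeriv contDiffOn_const fun z hz => by
    convert HasDirDeriv.const c using 1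
    ring

theorem const_mul (hU : IsOpen U) (c : ℝ) (hf : IsHom U r f) :
    IsHom U r (fun w => c * f w) :=
  ((const c).mul hU hf).cast (zero_add r)

theorem neg (hU : IsOpen U) (hf : IsHom U r f) : IsHom U r (fun w => -f w) :=
  of_hasDirDeriv hf.smooth.neg fun z hz => by
    convert (hf.radial hU hz).neg using 1
    ring

theorem sq (hU : IsOpen U) (hf : IsHom U r f) : IsHom U (2 * r) (fun w => f w ^ 2) :=
  of_hasDirDeriv (hf.smooth.pow 2) fun z hz => by
    convert (hf.radial hU hz).sq using 1
    ring

theorem inv (hU : IsOpen U) (hf : IsHom U r f) (h0 : ∀ z ∈ U, f z ≠ 0) :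
    IsHom U (-r) (fun w => (f w)⁻¹) :=
  of_hasDirDeriv (hf.smooth.inv h0) fun z hz => by
    convert (hf.radial hU hz).inv (h0 z hz) using 1
    have := h0 z hz
    field_simp

theorem sqrt (hU : IsOpen U) (hf : IsHom U r f) (h0 : ∀ z ∈ U, 0 < f z) :
    IsHom U (r / 2) (fun w => √(f w)) :=
  of_hasDirDeriv (hf.smooth.sqrt fun z hz => (h0 z hz).ne') fun z hz => by
    convert (hf.radial hU hz).sqrt (h0 z hz).ne' using 1
    have h1 := Real.sqrt_pos.2 (h0 z hz)
    have h2 := Real.mul_self_sqrt (h0 z hz).le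
    field_simp
    linear_combination r * h2

theorem exp (hU : IsOpen U) (hf : IsHom U 0 f) : IsHom U 0 (fun w => Real.exp (f w)) :=
  of_hasDirDeriv hf.smooth.exp fun z hz => by
    convert (hf.radial hU hz).exp using 1
    ring

theorem sum (hU : IsOpen U) {f : Fin 2 → Plane × Plane → ℝ} (hf : ∀ i, IsHom U r (f i)) :
    IsHom U r (fun w => ∑ i, f i w) := by
  simpa only [Fin.sum_univ_two] using (hf 0).add hU (hf 1)

theorem coord (i : Fin 2) : IsHom U 1 (fun w => w.2 i) := by
  refine of_hasDirDeriv ?_ fun z hz => ?_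
  · exact ((EuclideanSpace.proj i : Plane →L[ℝ] ℝ).comp
      (ContinuousLinearMap.snd ℝ Plane Plane)).contDiff.contDiffOn
  · convert HasDirDeriv.snd_apply (v := (0, z.2)) i using 1
    ring

theorem dx (hU : IsOpen U) (hf : IsHom U r f) (i : Fin 2) : IsHom U r (dx i f) := by
  refine of_hasDirDeriv (contDiffOn_fderiv_apply hU hf.smooth _) fun z hz => ?_
  have hy : ∀ j, HasDirDeriv (FinslerSurface.dy j f) z (EuclideanSpace.single i 1, 0)
      (fderiv ℝ (FinslerSurface.dy j f) z (EuclideanSpace.single i 1, 0)) := fun j =>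
    hasDirDeriv_of_contDiffOn hU (contDiffOn_fderiv_apply hU hf.smooth _) hz _
  have h := HasDirDeriv.unique hU hz (fun w hw => hf.euler hw)
    (((HasDirDeriv.snd_apply 0).mul (hy 0)).add ((HasDirDeriv.snd_apply 1).mul (hy 1)))
    ((hf.dx' hU hz i).const_mul r)
  refine ⟨(hasDirDeriv_of_contDiffOn hU (contDiffOn_fderiv_apply hU hf.smooth _) hz 0).1, ?_⟩
  rw [fderiv_apply_eq]
  have hc : ∀ j, fderiv ℝ (FinslerSurface.dy j f) z (EuclideanSpace.single i 1, 0) =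
      FinslerSurface.dy j (FinslerSurface.dx i f) z := fun j =>
    fderiv_fderiv_comm hU hf.smooth hz _ _
  rw [hc, hc] at h
  simpa using h

theorem dy (hU : IsOpen U) (hf : IsHom U r f) (i : Fin 2) : IsHom U (r - 1) (dy i f) := by
  refine of_hasDirDeriv (contDiffOn_fderiv_apply hU hf.smooth _) fun z hz => ?_
  have hy : ∀ j, HasDirDeriv (FinslerSurface.dy j f) z (0, EuclideanSpace.single i 1)
      (fderiv ℝ (FinslerSurface.dy j f) z (0, EuclideanSpace.single i 1)) := fun j =>
    hasDirDeriv_of_contDiffOn hU (contDiffOn_fderiv_apply hU hf.smooth _) hz _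
  have h := HasDirDeriv.unique hU hz (fun w hw => hf.euler hw)
    (((HasDirDeriv.snd_apply 0).mul (hy 0)).add ((HasDirDeriv.snd_apply 1).mul (hy 1)))
    ((hf.dy' hU hz i).const_mul r)
  refine ⟨(hasDirDeriv_of_contDiffOn hU (contDiffOn_fderiv_apply hU hf.smooth _) hz 0).1, ?_⟩
  rw [fderiv_apply_eq]
  have hc : ∀ j, fderiv ℝ (FinslerSurface.dy j f) z (0, EuclideanSpace.single i 1) =
      FinslerSurface.dy j (FinslerSurface.dy i f) z := fun j =>
    fderiv_fderiv_comm hU hf.smooth hz _ _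
  rw [hc, hc] at h
  fin_cases i <;> simp at h ⊢ <;> linear_combination h

theorem congr (hU : IsOpen U) (hf : IsHom U r f) (h : EqOn g f U) : IsHom U r g :=
  of_hasDirDeriv (hf.smooth.congr h) fun z hz => by
    have he := h.eventuallyEq_of_mem (hU.mem_nhds hz)
    refine ⟨(hf.dirDeriv hU hz 0).1.congr_of_eventuallyEq he, ?_⟩
    rw [he.fderiv_eq, hf.euler_fderiv z hz, h hz]

theorem dy_dy_comm (hU : IsOpen U) (hf : IsHom U r f) (hz : z ∈ U) (i j : Fin 2) :
    FinslerSurface.dy i (FinslerSurface.dy j f) z =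
      FinslerSurface.dy j (FinslerSurface.dy i f) z :=
  fderiv_fderiv_comm hU hf.smooth hz _ _

theorem dy_dx_comm (hU : IsOpen U) (hf : IsHom U r f) (hz : z ∈ U) (i j : Fin 2) :
    FinslerSurface.dy i (FinslerSurface.dx j f) z =
      FinslerSurface.dx j (FinslerSurface.dy i f) z :=
  fderiv_fderiv_comm hU hf.smooth hz _ _

theorem dy_dy_dy_comm (hU : IsOpen U) (hf : IsHom U r f) (hz : z ∈ U) (i j k : Fin 2) :
    FinslerSurface.dy i (FinslerSurface.dy j (FinslerSurface.dy k f)) z =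
      FinslerSurface.dy i (FinslerSurface.dy k (FinslerSurface.dy j f)) z := by
  have he : EqOn (FinslerSurface.dy j (FinslerSurface.dy k f))
      (FinslerSurface.dy k (FinslerSurface.dy j f)) U :=
    fun w hw => hf.dy_dy_comm hU hw j k
  exact HasDirDeriv.unique hU hz he (((hf.dy hU k).dy hU j).dy' hU hz i)
    (((hf.dy hU j).dy hU k).dy' hU hz i)

theorem dy_sq (hU : IsOpen U) (hf : IsHom U r f) (hz : z ∈ U) (i : Fin 2) :
    FinslerSurface.dy i (fun w => f w ^ 2) z = 2 * f z * FinslerSurface.dy i f z :=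
  ((hf.dy' hU hz i).sq).2

theorem dy_dy_sq (hU : IsOpen U) (hf : IsHom U r f) (hz : z ∈ U) (i j : Fin 2) :
    FinslerSurface.dy i (FinslerSurface.dy j fun w => f w ^ 2) z =
      2 * (f z * FinslerSurface.dy i (FinslerSurface.dy j f) z +
        FinslerSurface.dy i f z * FinslerSurface.dy j f z) := by
  have := HasDirDeriv.unique hU hz (fun w hw => hf.dy_sq hU hw j)
    (((hf.sq hU).dy hU j).dy' hU hz i)
    (((hf.dy' hU hz i).const_mul 2).mul ((hf.dy hU j).dy' hU hz i))
  rw [this]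
  ring

/-- Positive homogeneity implies Euler's identity. -/
theorem of_homogeneous (hU : IsOpen U) (hf : ContDiffOn ℝ ∞ f U) (n : ℕ)
    (h : ∀ z ∈ U, ∀ c : ℝ, 0 < c → f (z.1, c • z.2) = c ^ n * f z) : IsHom U n f := by
  refine ⟨hf, fun z hz => ?_⟩
  have h1 : HasDerivAt (fun c : ℝ => ((z.1, c • z.2) : Plane × Plane)) (0, z.2) 1 := by
    have := (hasDerivAt_id (1 : ℝ)).smul_const z.2
    simp only [one_smul] at this
    exact (hasDerivAt_const (1 : ℝ) z.1).prodMk this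
  have h2 : HasFDerivAt f (fderiv ℝ f z) ((fun c : ℝ => ((z.1, c • z.2) : Plane × Plane)) 1) := by
    simpa using (hasDirDeriv_of_contDiffOn hU hf hz 0).1.hasFDerivAt
  have h3 := h2.comp_hasDerivAt (1 : ℝ) h1
  have h4 : HasDerivAt (fun c : ℝ => c ^ n * f z) (n * f z) 1 := by
    simpa using (hasDerivAt_pow n (1 : ℝ)).mul_const (f z)
  refine h3.unique (h4.congr_of_eventuallyEq ?_)
  filter_upwards [lt_mem_nhds (show (0 : ℝ) < 1 by norm_num)] with c hc
  exact h z hz c hc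

end IsHom

/-! ### The geodesic spray and its connection -/

/-- `F` is a pseudo-Finsler metric on the open coordinate domain `U`. -/
structure IsLocalFinsler (U : Set (Plane × Plane)) (F : Plane × Plane → ℝ) : Prop where
  isOpen : IsOpen U
  hom : IsHom U 1 F
  det_ne : ∀ z ∈ U, metricDet F z ≠ 0

/-- The square `L = F²`, in terms of which the metric and the spray are defined. -/
abbrev normSq (F : Plane × Plane → ℝ) : Plane × Plane → ℝ := fun w => F w ^ 2

theorem metricDet_eq (F : Plane × Plane → ℝ) (z : Plane × Plane) :
    metricDet F z = 1 / 4 * (dy 0 (dy 0 (normSq F)) z * dy 1 (dy 1 (normSq F)) z -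
      dy 0 (dy 1 (normSq F)) z * dy 1 (dy 0 (normSq F)) z) := by
  simp only [metricDet, Matrix.det_fin_two, metric, Matrix.of_apply]
  ring

theorem sprayCoeff_zero_eq (F : Plane × Plane → ℝ) (z : Plane × Plane) :
    sprayCoeff F 0 z = 1 / 8 * ((metricDet F z)⁻¹ *
      (dy 1 (dy 1 (normSq F)) z * ((z.2 0 * dx 0 (dy 0 (normSq F)) z +
        z.2 1 * dx 1 (dy 0 (normSq F)) z) - dx 0 (normSq F) z) -
      dy 0 (dy 1 (normSq F)) z * ((z.2 0 * dx 0 (dy 1 (normSq F)) z +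
        z.2 1 * dx 1 (dy 1 (normSq F)) z) - dx 1 (normSq F) z))) := by
  simp only [sprayCoeff, Fin.sum_univ_two, Matrix.inv_def, Matrix.adjugate_fin_two,
    Ring.inverse_eq_inv', Matrix.smul_apply, smul_eq_mul, metricDet, Matrix.of_apply,
    Matrix.cons_val_zero, Matrix.cons_val_one, metric]
  ring

theorem sprayCoeff_one_eq (F : Plane × Plane → ℝ) (z : Plane × Plane) :
    sprayCoeff F 1 z = 1 / 8 * ((metricDet F z)⁻¹ *
      (dy 0 (dy 0 (normSq F)) z * ((z.2 0 * dx 0 (dy 1 (normSq F)) z +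
        z.2 1 * dx 1 (dy 1 (normSq F)) z) - dx 1 (normSq F) z) -
      dy 1 (dy 0 (normSq F)) z * ((z.2 0 * dx 0 (dy 0 (normSq F)) z +
        z.2 1 * dx 1 (dy 0 (normSq F)) z) - dx 0 (normSq F) z))) := by
  simp only [sprayCoeff, Fin.sum_univ_two, Matrix.inv_def, Matrix.adjugate_fin_two,
    Ring.inverse_eq_inv', Matrix.smul_apply, smul_eq_mul, metricDet, Matrix.of_apply,
    Matrix.cons_val_zero, Matrix.cons_val_one, metric]
  ring

theorem spray_eq (F f : Plane × Plane → ℝ) (z : Plane × Plane) :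
    spray F f z = z.2 0 * dx 0 f z + z.2 1 * dx 1 f z -
      2 * (sprayCoeff F 0 z * dy 0 f z + sprayCoeff F 1 z * dy 1 f z) := by
  simp only [spray, Fin.sum_univ_two]

theorem hderiv_eq (F f : Plane × Plane → ℝ) (i : Fin 2) (z : Plane × Plane) :
    hderiv F i f z = dx i f z - (barthel F 0 i z * dy 0 f z + barthel F 1 i z * dy 1 f z) := by
  simp only [hderiv, Fin.sum_univ_two]

/-- The tangent vector `S = (y, -2 G)` at `z`. -/
noncomputable def sprayVec (F : Plane × Plane → ℝ) (z : Plane × Plane) : Plane × Plane :=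
  (z.2, WithLp.toLp 2 fun i => -2 * sprayCoeff F i z)

theorem fderiv_sprayVec (F f : Plane × Plane → ℝ) (z : Plane × Plane) :
    fderiv ℝ f z (sprayVec F z) = spray F f z := by
  rw [fderiv_apply_eq, spray_eq]
  simp only [sprayVec]
  ring

/-- The tangent vector `δᵢ = (eᵢ, -Gʲᵢ)` at `z`. -/
noncomputable def hderivVec (F : Plane × Plane → ℝ) (i : Fin 2) (z : Plane × Plane) : Plane × Plane :=
  (EuclideanSpace.single i 1, WithLp.toLp 2 fun j => -barthel F j i z)

theorem fderiv_hderivVec (F f : Plane × Plane → ℝ) (i : Fin 2) (z : Plane × Plane) :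
    fderiv ℝ f z (hderivVec F i z) = hderiv F i f z := by
  rw [fderiv_apply_eq, hderiv_eq]
  fin_cases i <;> simp [hderivVec] <;> ring

namespace IsLocalFinsler

variable {U : Set (Plane × Plane)} {F : Plane × Plane → ℝ} {z : Plane × Plane}

theorem mono {V : Set (Plane × Plane)} (h : IsLocalFinsler U F) (hV : IsOpen V) (hVU : V ⊆ U) :
    IsLocalFinsler V F :=
  ⟨hV, h.hom.mono hVU, fun z hz => h.det_ne z (hVU hz)⟩

theorem normSq_hom (h : IsLocalFinsler U F) : IsHom U 2 (normSq F) :=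
  (h.hom.sq h.isOpen).cast (by norm_num)

theorem normSq_dy_hom (h : IsLocalFinsler U F) (i : Fin 2) : IsHom U 1 (dy i (normSq F)) :=
  (h.normSq_hom.dy h.isOpen i).cast (by norm_num)

theorem normSq_dy_dy_hom (h : IsLocalFinsler U F) (i j : Fin 2) :
    IsHom U 0 (dy i (dy j (normSq F))) :=
  ((h.normSq_dy_hom j).dy h.isOpen i).cast (by norm_num)

theorem metricDet_hom (h : IsLocalFinsler U F) : IsHom U 0 (metricDet F) := by
  have hm := fun a b c d => (h.normSq_dy_dy_hom a b).mul h.isOpen (h.normSq_dy_dy_hom c d)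
  have h2 := (((hm 0 0 1 1).sub h.isOpen (hm 0 1 1 0)).const_mul h.isOpen (1 / 4)).cast
    (add_zero 0)
  exact h2.congr h.isOpen fun z _ => metricDet_eq F z

theorem sprayCoeff_hom (h : IsLocalFinsler U F) (i : Fin 2) : IsHom U 2 (sprayCoeff F i) := by
  have ho := h.isOpen
  have hR : ∀ l, IsHom U 2 (fun z => (z.2 0 * dx 0 (dy l (normSq F)) z +
      z.2 1 * dx 1 (dy l (normSq F)) z) - dx l (normSq F) z) := fun l =>
    ((((IsHom.coord 0).mul ho ((h.normSq_dy_hom l).dx ho 0)).add ho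
      ((IsHom.coord 1).mul ho ((h.normSq_dy_hom l).dx ho 1))).cast (by norm_num)).sub ho
      (h.normSq_hom.dx ho l)
  have hm := fun a b l => (h.normSq_dy_dy_hom a b).mul ho (hR l)
  have hi := h.metricDet_hom.inv ho h.det_ne
  have key := fun a b c d k l => ((hi.mul ho ((hm a b k).sub ho (hm c d l))).const_mul ho
    (1 / 8)).cast (show (-0 + (0 + 2) : ℝ) = 2 by norm_num)
  fin_cases i
  · exact (key 1 1 0 1 0 1).congr ho fun z _ => sprayCoeff_zero_eq F z
  · exact (key 0 0 1 0 1 0).congr ho fun z _ => sprayCoeff_one_eq F z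

theorem barthel_hom (h : IsLocalFinsler U F) (i j : Fin 2) : IsHom U 1 (barthel F i j) :=
  ((h.sprayCoeff_hom i).dy h.isOpen j).cast (by norm_num)

theorem berwaldConn_hom (h : IsLocalFinsler U F) (i j k : Fin 2) :
    IsHom U 0 (berwaldConn F i j k) :=
  ((h.barthel_hom i k).dy h.isOpen j).cast (by norm_num)

theorem berwaldCurv_hom (h : IsLocalFinsler U F) (i j k l : Fin 2) :
    IsHom U (-1) (berwaldCurv F i j k l) :=
  ((h.berwaldConn_hom i j k).dy h.isOpen l).cast (by norm_num)

theorem berwaldConn_comm (h : IsLocalFinsler U F) (hz : z ∈ U) (i j k : Fin 2) :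
    berwaldConn F i j k z = berwaldConn F i k j z :=
  (h.sprayCoeff_hom i).dy_dy_comm h.isOpen hz j k

theorem berwaldCurv_comm₁₂ (h : IsLocalFinsler U F) (hz : z ∈ U) (i j k l : Fin 2) :
    berwaldCurv F i j k l z = berwaldCurv F i k j l z := by
  have he : EqOn (berwaldConn F i j k) (berwaldConn F i k j) U :=
    fun w hw => h.berwaldConn_comm hw i j k
  exact HasDirDeriv.unique h.isOpen hz he ((h.berwaldConn_hom i j k).dy' h.isOpen hz l)
    ((h.berwaldConn_hom i k j).dy' h.isOpen hz l)

theorem berwaldCurv_comm₁₃ (h : IsLocalFinsler U F) (hz : z ∈ U) (i j k l : Fin 2) :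
    berwaldCurv F i j k l z = berwaldCurv F i l k j z :=
  (h.barthel_hom i k).dy_dy_comm h.isOpen hz l j

theorem normSq_dy_dy_mul_sprayCoeff (h : IsLocalFinsler U F) (hz : z ∈ U) (l : Fin 2) :
    dy l (dy 0 (normSq F)) z * sprayCoeff F 0 z + dy l (dy 1 (normSq F)) z * sprayCoeff F 1 z =
      1 / 2 * (z.2 0 * dx 0 (dy l (normSq F)) z + z.2 1 * dx 1 (dy l (normSq F)) z -
        dx l (normSq F) z) := by
  have hd := h.det_ne z hz
  have hc := h.normSq_hom.dy_dy_comm h.isOpen hz 0 1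
  have he := metricDet_eq F z
  rw [sprayCoeff_zero_eq, sprayCoeff_one_eq]
  have hi := mul_inv_cancel₀ hd
  revert l
  rw [Fin.forall_fin_two, hc]
  rw [hc] at he
  constructor
  · linear_combination (1 / 2 * (z.2 0 * dx 0 (dy 0 (normSq F)) z +
      z.2 1 * dx 1 (dy 0 (normSq F)) z - dx 0 (normSq F) z)) * (hi - (metricDet F z)⁻¹ * he)
  · linear_combination (1 / 2 * (z.2 0 * dx 0 (dy 1 (normSq F)) z +
      z.2 1 * dx 1 (dy 1 (normSq F)) z - dx 1 (normSq F) z)) * (hi - (metricDet F z)⁻¹ * he)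

/-- The spray equation `S(∂̇ₗ F²) = ∂ₗ F²`. -/
theorem spray_dy_normSq (h : IsLocalFinsler U F) (hz : z ∈ U) (l : Fin 2) :
    spray F (dy l (normSq F)) z = dx l (normSq F) z := by
  have h1 := h.normSq_dy_dy_mul_sprayCoeff hz l
  rw [spray_eq, h.normSq_hom.dy_dy_comm h.isOpen hz 0 l, h.normSq_hom.dy_dy_comm h.isOpen hz 1 l]
  linear_combination (-2) * h1

theorem spray_hom (h : IsLocalFinsler U F) {r : ℝ} {f : Plane × Plane → ℝ} (hf : IsHom U r f) :
    IsHom U (1 + r) (spray F f) := by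
  have ho := h.isOpen
  have h1 := ((IsHom.coord 0).mul ho (hf.dx ho 0)).add ho ((IsHom.coord 1).mul ho (hf.dx ho 1))
  have h2 := (((h.sprayCoeff_hom 0).mul ho (hf.dy ho 0)).add ho
    ((h.sprayCoeff_hom 1).mul ho (hf.dy ho 1))).const_mul ho 2
  exact (h1.sub ho (h2.cast (by ring))).congr ho fun z _ => spray_eq F f z

/-- The commutator `[∂̇ₖ, S] = ∂ₖ - 2 Gʲₖ ∂̇ⱼ`. -/
theorem dy_spray (h : IsLocalFinsler U F) {r : ℝ} {f : Plane × Plane → ℝ} (hf : IsHom U r f)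
    (hz : z ∈ U) (k : Fin 2) :
    dy k (spray F f) z = spray F (dy k f) z + dx k f z -
      2 * (barthel F 0 k z * dy 0 f z + barthel F 1 k z * dy 1 f z) := by
  have ho := h.isOpen
  have h1 := ((HasDirDeriv.snd_apply 0).mul ((hf.dx ho 0).dy' ho hz k)).add
    ((HasDirDeriv.snd_apply 1).mul ((hf.dx ho 1).dy' ho hz k))
  have h2 := ((((h.sprayCoeff_hom 0).dy' ho hz k).mul ((hf.dy ho 0).dy' ho hz k)).add
    (((h.sprayCoeff_hom 1).dy' ho hz k).mul ((hf.dy ho 1).dy' ho hz k))).const_mul 2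
  have h3 := HasDirDeriv.unique ho hz (fun w _ => spray_eq F f w)
    ((h.spray_hom hf).dy' ho hz k) (h1.sub h2)
  rw [h3, spray_eq, hf.dy_dx_comm ho hz, hf.dy_dx_comm ho hz, hf.dy_dy_comm ho hz k 0,
    hf.dy_dy_comm ho hz k 1]
  unfold barthel
  fin_cases k <;> simp <;> ring

theorem barthel_mul_snd (h : IsLocalFinsler U F) (hz : z ∈ U) (i : Fin 2) :
    z.2 0 * barthel F i 0 z + z.2 1 * barthel F i 1 z = 2 * sprayCoeff F i z :=
  (h.sprayCoeff_hom i).euler hz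

/-- `S = yⁱ δᵢ`. -/
theorem spray_eq_hderiv (h : IsLocalFinsler U F) (hz : z ∈ U) (f : Plane × Plane → ℝ) :
    spray F f z = z.2 0 * hderiv F 0 f z + z.2 1 * hderiv F 1 f z := by
  rw [spray_eq, hderiv_eq, hderiv_eq]
  linear_combination dy 0 f z * h.barthel_mul_snd hz 0 + dy 1 f z * h.barthel_mul_snd hz 1

/-- Where `F` vanishes, `gᵢⱼ = ∂̇ᵢF ∂̇ⱼF` has rank at most one. -/
theorem ne_zero (h : IsLocalFinsler U F) (hz : z ∈ U) : F z ≠ 0 := by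
  intro h0
  refine h.det_ne z hz ?_
  simp only [metricDet_eq, h.hom.dy_dy_sq h.isOpen hz, h0]
  ring

theorem snd_ne_zero (h : IsLocalFinsler U F) (hz : z ∈ U) : ¬(z.2 0 = 0 ∧ z.2 1 = 0) := by
  rintro ⟨h0, h1⟩
  have := h.hom.euler hz
  rw [h0, h1] at this
  apply h.ne_zero hz
  linarith

/-- `S(F²) = 0`. -/
theorem spray_normSq (h : IsLocalFinsler U F) (hz : z ∈ U) : spray F (normSq F) z = 0 := by
  have ho := h.isOpen
  have hL := h.normSq_hom
  have h0 := h.spray_dy_normSq hz 0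
  have h1 := h.spray_dy_normSq hz 1
  have e0 := (hL.dx ho 0).euler hz
  have e1 := (hL.dx ho 1).euler hz
  have f0 := (h.normSq_dy_hom 0).euler hz
  have f1 := (h.normSq_dy_hom 1).euler hz
  rw [hL.dy_dx_comm ho hz, hL.dy_dx_comm ho hz] at e0 e1
  rw [spray_eq] at *
  rw [hL.dy_dy_comm ho hz 0 1] at *
  linear_combination z.2 0 * h0 + z.2 1 * h1 - z.2 0 * e0 - z.2 1 * e1 +
    2 * sprayCoeff F 0 z * f0 + 2 * sprayCoeff F 1 z * f1

/-- `∂ₘ F² = Gʲₘ ∂̇ⱼ F²`, that is, `δₘ F² = 0`. -/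
theorem dx_normSq (h : IsLocalFinsler U F) (hz : z ∈ U) (m : Fin 2) :
    dx m (normSq F) z =
      barthel F 0 m z * dy 0 (normSq F) z + barthel F 1 m z * dy 1 (normSq F) z := by
  have ho := h.isOpen
  have h1 := h.dy_spray h.normSq_hom hz m
  have h2 := HasDirDeriv.unique ho hz (fun w hw => h.spray_normSq hw)
    ((h.spray_hom h.normSq_hom).dy' ho hz m) (HasDirDeriv.const 0)
  have h3 := h.spray_dy_normSq hz m
  linarith

/-- The first derivative in `y` of `δₘ F² = 0`. -/
theorem dx_dy_normSq (h : IsLocalFinsler U F) (hz : z ∈ U) (m k : Fin 2) :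
    dx m (dy k (normSq F)) z =
      berwaldConn F 0 k m z * dy 0 (normSq F) z + barthel F 0 m z * dy k (dy 0 (normSq F)) z +
      (berwaldConn F 1 k m z * dy 1 (normSq F) z +
        barthel F 1 m z * dy k (dy 1 (normSq F)) z) := by
  have ho := h.isOpen
  rw [← h.normSq_hom.dy_dx_comm ho hz]
  exact HasDirDeriv.unique ho hz (fun w hw => h.dx_normSq hw m)
    ((h.normSq_hom.dx ho m).dy' ho hz k)
    ((((h.barthel_hom 0 m).dy' ho hz k).mul ((h.normSq_dy_hom 0).dy' ho hz k)).add
      (((h.barthel_hom 1 m).dy' ho hz k).mul ((h.normSq_dy_hom 1).dy' ho hz k)))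

/-- The second derivative in `y` of `δₘ F² = 0`. -/
theorem dx_dy_dy_normSq (h : IsLocalFinsler U F) (hz : z ∈ U) (m k l : Fin 2) :
    dx m (dy l (dy k (normSq F))) z =
      berwaldCurv F 0 k m l z * dy 0 (normSq F) z + berwaldCurv F 1 k m l z * dy 1 (normSq F) z +
      (berwaldConn F 0 k m z * dy l (dy 0 (normSq F)) z +
        berwaldConn F 1 k m z * dy l (dy 1 (normSq F)) z) +
      (berwaldConn F 0 l m z * dy k (dy 0 (normSq F)) z +
        berwaldConn F 1 l m z * dy k (dy 1 (normSq F)) z) +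
      (barthel F 0 m z * dy l (dy k (dy 0 (normSq F))) z +
        barthel F 1 m z * dy l (dy k (dy 1 (normSq F))) z) := by
  have ho := h.isOpen
  rw [← (h.normSq_dy_hom k).dy_dx_comm ho hz]
  have := HasDirDeriv.unique ho hz (fun w hw => h.dx_dy_normSq hw m k)
    (((h.normSq_dy_hom k).dx ho m).dy' ho hz l)
    (((((h.berwaldConn_hom 0 k m).dy' ho hz l).mul ((h.normSq_dy_hom 0).dy' ho hz l)).add
      (((h.barthel_hom 0 m).dy' ho hz l).mul ((h.normSq_dy_dy_hom k 0).dy' ho hz l))).add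
     ((((h.berwaldConn_hom 1 k m).dy' ho hz l).mul ((h.normSq_dy_hom 1).dy' ho hz l)).add
      (((h.barthel_hom 1 m).dy' ho hz l).mul ((h.normSq_dy_dy_hom k 1).dy' ho hz l))))
  rw [this]
  unfold berwaldCurv berwaldConn
  ring

/-- Along the geodesic spray the metric is parallel: `S(∂̇ₗ∂̇ₖF²) = Gʲₖ ∂̇ⱼ∂̇ₗF² + Gʲₗ ∂̇ⱼ∂̇ₖF²`. -/
theorem spray_dy_dy_normSq (h : IsLocalFinsler U F) (hz : z ∈ U) (k l : Fin 2) :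
    spray F (dy k (dy l (normSq F))) z =
      barthel F 0 k z * dy l (dy 0 (normSq F)) z + barthel F 1 k z * dy l (dy 1 (normSq F)) z +
      (barthel F 0 l z * dy k (dy 0 (normSq F)) z +
        barthel F 1 l z * dy k (dy 1 (normSq F)) z) := by
  have ho := h.isOpen
  have h1 := h.dy_spray (h.normSq_dy_hom l) hz k
  have h2 := HasDirDeriv.unique ho hz (fun w hw => h.spray_dy_normSq hw l)
    ((h.spray_hom (h.normSq_dy_hom l)).dy' ho hz k) ((h.normSq_hom.dx ho l).dy' ho hz k)
  have h3 := h.dx_dy_normSq hz l k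
  have h4 := h.dx_dy_normSq hz k l
  rw [h.normSq_hom.dy_dx_comm ho hz, h3] at h2
  rw [h2, h4, h.berwaldConn_comm hz 0 k l, h.berwaldConn_comm hz 1 k l,
    h.normSq_hom.dy_dy_comm ho hz 0 l, h.normSq_hom.dy_dy_comm ho hz 1 l] at h1
  linarith

/-- The covariant derivative of `∂̇ₘ∂̇ₖ∂̇ₗF²` along the spray is `-(∂̇ⱼF²) Gʲₖₗₘ`. -/
theorem spray_dy_dy_dy_normSq (h : IsLocalFinsler U F) (hz : z ∈ U) (m k l : Fin 2) :
    spray F (dy m (dy k (dy l (normSq F)))) z =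
      barthel F 0 k z * dy m (dy l (dy 0 (normSq F))) z +
        barthel F 1 k z * dy m (dy l (dy 1 (normSq F))) z +
      (barthel F 0 l z * dy m (dy k (dy 0 (normSq F))) z +
        barthel F 1 l z * dy m (dy k (dy 1 (normSq F))) z) +
      (barthel F 0 m z * dy l (dy k (dy 0 (normSq F))) z +
        barthel F 1 m z * dy l (dy k (dy 1 (normSq F))) z) -
      (berwaldCurv F 0 k l m z * dy 0 (normSq F) z +
        berwaldCurv F 1 k l m z * dy 1 (normSq F) z) := by
  have ho := h.isOpen
  have hLL := h.normSq_dy_dy_hom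
  have h1 := h.dy_spray (hLL k l) hz m
  have h2 := HasDirDeriv.unique ho hz (fun w hw => h.spray_dy_dy_normSq hw k l)
    ((h.spray_hom (hLL k l)).dy' ho hz m)
    (((((h.barthel_hom 0 k).dy' ho hz m).mul ((hLL l 0).dy' ho hz m)).add
      (((h.barthel_hom 1 k).dy' ho hz m).mul ((hLL l 1).dy' ho hz m))).add
     ((((h.barthel_hom 0 l).dy' ho hz m).mul ((hLL k 0).dy' ho hz m)).add
      (((h.barthel_hom 1 l).dy' ho hz m).mul ((hLL k 1).dy' ho hz m))))
  have h3 := h.dx_dy_dy_normSq hz m l k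
  have c3 : ∀ j, dy j (dy k (dy l (normSq F))) z = dy l (dy k (dy j (normSq F))) z := fun j => by
    rw [(h.normSq_dy_hom l).dy_dy_comm ho hz j k, h.normSq_hom.dy_dy_dy_comm ho hz k j l,
      (h.normSq_dy_hom j).dy_dy_comm ho hz k l]
  have cB : ∀ j, berwaldCurv F j l m k z = berwaldCurv F j k l m z := fun j => by
    rw [h.berwaldCurv_comm₁₂ hz j l m k, h.berwaldCurv_comm₁₃ hz j m l k]
  rw [c3, c3, h3, cB, cB, (h.normSq_dy_hom 0).dy_dy_comm ho hz k l,
    (h.normSq_dy_hom 1).dy_dy_comm ho hz k l] at h1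
  have cC : ∀ i j, dy m (barthel F i j) z = berwaldConn F i j m z := fun i j =>
    h.berwaldConn_comm hz i m j
  rw [cC, cC, cC, cC] at h2
  linarith

end IsLocalFinsler

/-! ### The Berwald frame and the main scalar -/

theorem sig_mul_self {F : Plane × Plane → ℝ} {z : Plane × Plane} (h : metricDet F z ≠ 0) :
    sig F z * sig F z = 1 := by
  unfold sig
  rcases lt_or_gt_of_ne h with h | h
  · rw [Real.sign_of_neg h]
    norm_num
  · rw [Real.sign_of_pos h]
    norm_num

theorem sig_mul_metricDet_pos {F : Plane × Plane → ℝ} {z : Plane × Plane}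
    (h : metricDet F z ≠ 0) : 0 < sig F z * metricDet F z := by
  unfold sig
  rcases lt_or_gt_of_ne h with h | h
  · rw [Real.sign_of_neg h]
    linarith
  · rw [Real.sign_of_pos h]
    linarith

/-- The factor `ε / √(ε det g)` of the frame vector `m`. -/
noncomputable def frameScale (F : Plane × Plane → ℝ) (z : Plane × Plane) : ℝ :=
  sig F z * (√(sig F z * metricDet F z))⁻¹

theorem mUp_zero (F : Plane × Plane → ℝ) (z : Plane × Plane) :
    mUp F 0 z = -(frameScale F z * dy 1 F z) := by
  simp [mUp, frameScale, ellLow, div_eq_mul_inv]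

theorem mUp_one (F : Plane × Plane → ℝ) (z : Plane × Plane) :
    mUp F 1 z = frameScale F z * dy 0 F z := by
  simp [mUp, frameScale, ellLow, div_eq_mul_inv]

theorem frameScale_sq_mul {F : Plane × Plane → ℝ} {z : Plane × Plane} (h : metricDet F z ≠ 0) :
    frameScale F z ^ 2 * metricDet F z = sig F z := by
  have h1 := sig_mul_self h
  have h2 := sig_mul_metricDet_pos h
  have h3 := Real.sq_sqrt h2.le
  have h4 := Real.sqrt_pos.2 h2
  unfold frameScale
  rw [mul_pow, inv_pow, h3, pow_two, h1]
  have h5 : sig F z ≠ 0 := left_ne_zero_of_mul h2.ne'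
  field_simp
  rw [pow_two, h1]

theorem frameScale_ne_zero {F : Plane × Plane → ℝ} {z : Plane × Plane} (h : metricDet F z ≠ 0) :
    frameScale F z ≠ 0 := by
  intro h0
  have h1 := frameScale_sq_mul h
  have h2 := sig_mul_self h
  rw [h0] at h1
  rw [← h1] at h2
  norm_num at h2

/-- In a basis `y, m` of the plane a covector is determined by its values on `y` and `m`. -/
theorem eq_zero_of_contract_eq_zero {y m t : Fin 2 → ℝ} (hne : y 0 * m 1 - y 1 * m 0 ≠ 0)
    (hy : y 0 * t 0 + y 1 * t 1 = 0) (hm : m 0 * t 0 + m 1 * t 1 = 0) (i : Fin 2) : t i = 0 := by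
  revert i
  rw [Fin.forall_fin_two]
  constructor <;> refine (mul_eq_zero.1 ?_).resolve_left hne
  · linear_combination m 1 * hy - y 1 * hm
  · linear_combination y 0 * hm - m 0 * hy

/-- A symmetric cubic form on the plane that kills `y` vanishes once it vanishes on `m`. -/
theorem cubic_eq_zero {y m : Fin 2 → ℝ} {T : Fin 2 → Fin 2 → Fin 2 → ℝ}
    (hne : y 0 * m 1 - y 1 * m 0 ≠ 0) (h12 : ∀ i j k, T i j k = T j i k)
    (h13 : ∀ i j k, T i j k = T k j i) (hy : ∀ i j, y 0 * T i j 0 + y 1 * T i j 1 = 0)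
    (hm : ∑ i, ∑ j, ∑ k, T i j k * m i * m j * m k = 0) (i j k : Fin 2) : T i j k = 0 := by
  have h23 : ∀ i j k, T i j k = T i k j := fun i j k => by rw [h12 i j k, h13 j i k, h12 k i j]
  have hy2 : ∀ i k, y 0 * T i 0 k + y 1 * T i 1 k = 0 := fun i k => by
    rw [h23 i 0 k, h23 i 1 k]
    exact hy i k
  have hy1 : ∀ j k, y 0 * T 0 j k + y 1 * T 1 j k = 0 := fun j k => by
    rw [h12 0, h12 1]
    exact hy2 j k
  simp only [Fin.sum_univ_two] at hm
  have A : ∀ i, ∑ j, ∑ k, T i j k * m j * m k = 0 :=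
    eq_zero_of_contract_eq_zero (t := fun i => ∑ j, ∑ k, T i j k * m j * m k) hne (by
      simp only [Fin.sum_univ_two]
      linear_combination m 0 * m 0 * hy1 0 0 + m 0 * m 1 * hy1 0 1 + m 1 * m 0 * hy1 1 0 +
        m 1 * m 1 * hy1 1 1) (by
      simp only [Fin.sum_univ_two]
      linear_combination hm)
  have B : ∀ i j, ∑ k, T i j k * m k = 0 := fun i =>
    eq_zero_of_contract_eq_zero (t := fun j => ∑ k, T i j k * m k) hne (by
      simp only [Fin.sum_univ_two]
      linear_combination m 0 * hy2 i 0 + m 1 * hy2 i 1) (by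
      have := A i
      simp only [Fin.sum_univ_two] at this ⊢
      linear_combination this)
  exact eq_zero_of_contract_eq_zero (t := T i j) hne (hy i j) (by
    have := B i j
    simp only [Fin.sum_univ_two] at this
    linear_combination this) k

namespace IsLocalFinsler

variable {U : Set (Plane × Plane)} {F : Plane × Plane → ℝ} {z : Plane × Plane}

/-- The signature is locally constant. -/
theorem sig_eventuallyEq (h : IsLocalFinsler U F) (hz : z ∈ U) :
    sig F =ᶠ[nhds z] fun _ => sig F z := by
  have hc : ContinuousAt (metricDet F) z :=
    h.metricDet_hom.smooth.continuousOn.continuousAt (h.isOpen.mem_nhds hz)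
  unfold sig
  rcases lt_or_gt_of_ne (h.det_ne z hz) with h0 | h0
  · filter_upwards [hc.eventually (gt_mem_nhds h0)] with w hw
    rw [Real.sign_of_neg h0, Real.sign_of_neg hw]
  · filter_upwards [hc.eventually (lt_mem_nhds h0)] with w hw
    rw [Real.sign_of_pos h0, Real.sign_of_pos hw]

theorem sig_dirDeriv (h : IsLocalFinsler U F) (hz : z ∈ U) (v : Plane × Plane) :
    HasDirDeriv (sig F) z v 0 := by
  have he := h.sig_eventuallyEq hz
  refine ⟨(differentiableAt_const _).congr_of_eventuallyEq he, ?_⟩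
  rw [he.fderiv_eq, fderiv_fun_const]
  rfl

theorem sig_hom (h : IsLocalFinsler U F) : IsHom U 0 (sig F) := by
  refine IsHom.of_hasDirDeriv (fun w hw => ?_) fun w hw => ?_
  · exact (contDiffAt_const.congr_of_eventuallyEq (h.sig_eventuallyEq hw)).contDiffWithinAt
  · simpa using h.sig_dirDeriv hw (0, w.2)

theorem frameScale_hom (h : IsLocalFinsler U F) : IsHom U 0 (frameScale F) := by
  have ho := h.isOpen
  have hp : ∀ z ∈ U, 0 < sig F z * metricDet F z := fun z hz => sig_mul_metricDet_pos (h.det_ne z hz)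
  exact (h.sig_hom.mul ho (((h.sig_hom.mul ho h.metricDet_hom).sqrt ho hp).inv ho
    fun z hz => (Real.sqrt_pos.2 (hp z hz)).ne')).cast (by norm_num)

theorem mUp_hom (h : IsLocalFinsler U F) (i : Fin 2) : IsHom U 0 (mUp F i) := by
  have ho := h.isOpen
  have hm := fun j => (h.frameScale_hom.mul ho (h.hom.dy ho j)).cast (s := 0) (by norm_num)
  revert i
  rw [Fin.forall_fin_two]
  exact ⟨((hm 1).neg ho).congr ho fun z _ => mUp_zero F z, (hm 0).congr ho fun z _ => mUp_one F z⟩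

theorem cartan_hom (h : IsLocalFinsler U F) (i j k : Fin 2) : IsHom U (-1) (cartan F i j k) :=
  (((h.normSq_dy_dy_hom j k).dy h.isOpen i).const_mul h.isOpen (1 / 4)).cast (by norm_num)

theorem mainScalar_hom (h : IsLocalFinsler U F) : IsHom U 0 (mainScalar F) := by
  have ho := h.isOpen
  have hm := h.mUp_hom
  exact ((h.sig_hom.mul ho h.hom).mul ho (IsHom.sum ho fun i => IsHom.sum ho fun j =>
    IsHom.sum ho fun k => (((h.cartan_hom i j k).mul ho (hm i)).mul ho (hm j)).mul ho
      (hm k))).cast (by norm_num)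

/-- The directions `y` and `m` are linearly independent. -/
theorem snd_wedge_mUp (h : IsLocalFinsler U F) (hz : z ∈ U) :
    z.2 0 * mUp F 1 z - z.2 1 * mUp F 0 z = frameScale F z * F z := by
  rw [mUp_zero, mUp_one]
  linear_combination frameScale F z * h.hom.euler hz

theorem snd_wedge_mUp_ne_zero (h : IsLocalFinsler U F) (hz : z ∈ U) :
    z.2 0 * mUp F 1 z - z.2 1 * mUp F 0 z ≠ 0 := by
  rw [h.snd_wedge_mUp hz]
  exact mul_ne_zero (frameScale_ne_zero (h.det_ne z hz)) (h.ne_zero hz)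

section Transport

variable {v : Plane × Plane} {N : Fin 2 → Fin 2 → ℝ}

/-- If the derivative `D` in the direction `v` acts on `F²` and its first and second derivatives
in `y` as parallel transport with connection matrix `N` would, then it does so on `m`. -/
theorem fderiv_mUp (h : IsLocalFinsler U F) (hz : z ∈ U)
    (h0 : fderiv ℝ (normSq F) z v = 0)
    (h1 : ∀ i, fderiv ℝ (dy i (normSq F)) z v =
      N 0 i * dy 0 (normSq F) z + N 1 i * dy 1 (normSq F) z)
    (h2 : ∀ k l, fderiv ℝ (dy k (dy l (normSq F))) z v =
      N 0 k * dy l (dy 0 (normSq F)) z + N 1 k * dy l (dy 1 (normSq F)) z +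
        (N 0 l * dy k (dy 0 (normSq F)) z + N 1 l * dy k (dy 1 (normSq F)) z)) (i : Fin 2) :
    fderiv ℝ (mUp F i) z v = -(N i 0 * mUp F 0 z + N i 1 * mUp F 1 z) := by
  have ho := h.isOpen
  have hF := h.ne_zero hz
  have hd := h.det_ne z hz
  have hs := frameScale_ne_zero hd
  have hD : ∀ {r : ℝ} {f : Plane × Plane → ℝ}, IsHom U r f →
      HasDirDeriv f z v (fderiv ℝ f z v) := fun hf => hf.dirDeriv ho hz v
  have e0 : fderiv ℝ F z v = 0 := by
    have := (hD h.hom).sq.2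
    rw [h0] at this
    simpa [hF] using this.symm
  have e1 : ∀ i, fderiv ℝ (dy i F) z v = N 0 i * dy 0 F z + N 1 i * dy 1 F z := by
    intro i
    have := HasDirDeriv.unique ho hz (fun w hw => h.hom.dy_sq ho hw i) (hD (h.normSq_dy_hom i))
      (((hD h.hom).const_mul 2).mul (hD (h.hom.dy ho i)))
    rw [h1, e0, h.hom.dy_sq ho hz, h.hom.dy_sq ho hz] at this
    apply mul_left_cancel₀ hF
    linear_combination (-1 / 2) * this
  have hc := h.normSq_hom.dy_dy_comm ho hz 0 1
  have e2 : fderiv ℝ (metricDet F) z v = 2 * (N 0 0 + N 1 1) * metricDet F z := by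
    have := HasDirDeriv.unique ho hz (fun w _ => metricDet_eq F w) (hD h.metricDet_hom)
      ((((hD (h.normSq_dy_dy_hom 0 0)).mul (hD (h.normSq_dy_dy_hom 1 1))).sub
        ((hD (h.normSq_dy_dy_hom 0 1)).mul (hD (h.normSq_dy_dy_hom 1 0)))).const_mul (1 / 4))
    rw [this, metricDet_eq, h2, h2, h2, h2, hc]
    ring
  have e3 : fderiv ℝ (frameScale F) z v = -(N 0 0 + N 1 1) * frameScale F z := by
    have := HasDirDeriv.unique ho hz (fun w hw => frameScale_sq_mul (h.det_ne w hw))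
      ((hD h.frameScale_hom).sq.mul (hD h.metricDet_hom)) (h.sig_dirDeriv hz v)
    rw [e2] at this
    apply mul_left_cancel₀ (mul_ne_zero hs hd)
    linear_combination (1 / 2) * this
  revert i
  rw [Fin.forall_fin_two]
  constructor
  · rw [HasDirDeriv.unique ho hz (fun w _ => mUp_zero F w) (hD (h.mUp_hom 0))
      ((hD h.frameScale_hom).mul (hD (h.hom.dy ho 1))).neg, mUp_zero, mUp_one, e1, e3]
    ring
  · rw [HasDirDeriv.unique ho hz (fun w _ => mUp_one F w) (hD (h.mUp_hom 1))
      ((hD h.frameScale_hom).mul (hD (h.hom.dy ho 0))), mUp_zero, mUp_one, e1, e3]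
    ring

/-- Under the hypotheses of `fderiv_mUp`, the derivative of the main scalar is the component along
`m` of the defect `T` by which `∂̇ᵢ∂̇ⱼ∂̇ₖF²` fails to be parallel. -/
theorem fderiv_mainScalar (h : IsLocalFinsler U F) (hz : z ∈ U)
    (h0 : fderiv ℝ (normSq F) z v = 0)
    (h1 : ∀ i, fderiv ℝ (dy i (normSq F)) z v =
      N 0 i * dy 0 (normSq F) z + N 1 i * dy 1 (normSq F) z)
    (h2 : ∀ k l, fderiv ℝ (dy k (dy l (normSq F))) z v =
      N 0 k * dy l (dy 0 (normSq F)) z + N 1 k * dy l (dy 1 (normSq F)) z +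
        (N 0 l * dy k (dy 0 (normSq F)) z + N 1 l * dy k (dy 1 (normSq F)) z))
    {T : Fin 2 → Fin 2 → Fin 2 → ℝ}
    (h3 : ∀ m k l, fderiv ℝ (dy m (dy k (dy l (normSq F)))) z v =
      N 0 k * dy m (dy l (dy 0 (normSq F))) z + N 1 k * dy m (dy l (dy 1 (normSq F))) z +
      (N 0 l * dy m (dy k (dy 0 (normSq F))) z + N 1 l * dy m (dy k (dy 1 (normSq F))) z) +
      (N 0 m * dy l (dy k (dy 0 (normSq F))) z + N 1 m * dy l (dy k (dy 1 (normSq F))) z) +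
      T m k l) :
    fderiv ℝ (mainScalar F) z v = sig F z * F z / 4 *
      ∑ i, ∑ j, ∑ k, T i j k * mUp F i z * mUp F j z * mUp F k z := by
  have ho := h.isOpen
  have hD : ∀ {r : ℝ} {f : Plane × Plane → ℝ}, IsHom U r f →
      HasDirDeriv f z v (fderiv ℝ f z v) := fun hf => hf.dirDeriv ho hz v
  have e0 : fderiv ℝ F z v = 0 := by
    have := (hD h.hom).sq.2
    rw [h0] at this
    simpa [h.ne_zero hz] using this.symm
  have em := h.fderiv_mUp hz h0 h1 h2
  have hm : ∀ i, HasDirDeriv (mUp F i) z v _ := fun i => hD (h.mUp_hom i)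
  have hC : ∀ i j k, HasDirDeriv (cartan F i j k) z v
      (1 / 4 * fderiv ℝ (dy i (dy j (dy k (normSq F)))) z v) := fun i j k =>
    (hD ((h.normSq_dy_dy_hom j k).dy ho i)).const_mul (1 / 4)
  have key : HasDirDeriv (mainScalar F) z v _ :=
    ((h.sig_dirDeriv hz v).mul (hD h.hom)).mul
    (HasDirDeriv.sum fun i => HasDirDeriv.sum fun j => HasDirDeriv.sum fun k =>
      (((hC i j k).mul (hm i)).mul (hm j)).mul (hm k))
  have hL := h.normSq_hom
  have s1 := hL.dy_dy_dy_comm ho hz 0 1 0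
  have s2 := hL.dy_dy_dy_comm ho hz 1 1 0
  have s3 : dy 1 (dy 0 (dy 0 (normSq F))) z = dy 0 (dy 0 (dy 1 (normSq F))) z := by
    rw [(h.normSq_dy_hom 0).dy_dy_comm ho hz 1 0, s1]
  have s4 : dy 1 (dy 0 (dy 1 (normSq F))) z = dy 0 (dy 1 (dy 1 (normSq F))) z :=
    (h.normSq_dy_hom 1).dy_dy_comm ho hz 1 0
  rw [s4] at s2
  rw [key.2, e0]
  simp only [Fin.sum_univ_two, em, h3, cartan]
  simp only [s1, s2, s3, s4]
  ring

end Transport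

/-- The Landsberg scalar is, up to a factor, the component of `(∂̇ₕF²) Gʰᵢⱼₖ` along `m`. -/
theorem landsbergScalar_eq (h : IsLocalFinsler U F) (hz : z ∈ U) :
    landsbergScalar F z = -(sig F z * F z / 4 * ∑ i, ∑ j, ∑ k,
      (berwaldCurv F 0 i j k z * dy 0 (normSq F) z + berwaldCurv F 1 i j k z *
        dy 1 (normSq F) z) * mUp F i z * mUp F j z * mUp F k z) := by
  unfold landsbergScalar
  rw [← fderiv_sprayVec, h.fderiv_mainScalar hz (v := sprayVec F z)
    (N := fun j i => barthel F j i z) (T := fun i j k =>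
      -(berwaldCurv F 0 i j k z * dy 0 (normSq F) z + berwaldCurv F 1 i j k z *
        dy 1 (normSq F) z))]
  · simp only [Fin.sum_univ_two]
    ring
  · rw [fderiv_sprayVec, h.spray_normSq hz]
  · intro i
    rw [fderiv_sprayVec, h.spray_dy_normSq hz, h.dx_normSq hz]
  · intro k l
    rw [fderiv_sprayVec, h.spray_dy_dy_normSq hz]
  · intro m k l
    rw [fderiv_sprayVec, h.spray_dy_dy_dy_normSq hz]
    have cB : ∀ j, berwaldCurv F j k l m z = berwaldCurv F j m k l z := fun j => by
      rw [h.berwaldCurv_comm₁₂ hz j m k l, h.berwaldCurv_comm₁₃ hz j k m l,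
        h.berwaldCurv_comm₁₂ hz j l m k, h.berwaldCurv_comm₁₃ hz j m l k,
        h.berwaldCurv_comm₁₂ hz j k l m, h.berwaldCurv_comm₁₃ hz j l k m,
        h.berwaldCurv_comm₁₂ hz j m k l, h.berwaldCurv_comm₁₃ hz j k m l]
    rw [cB, cB]
    ring

theorem berwaldCurv_mul_snd (h : IsLocalFinsler U F) (hz : z ∈ U) (i j k : Fin 2) :
    z.2 0 * berwaldCurv F i j k 0 z + z.2 1 * berwaldCurv F i j k 1 z = 0 := by
  have := (h.berwaldConn_hom i j k).euler hz
  rwa [zero_mul] at this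

/-- Where the Landsberg scalar vanishes, `(∂̇ₕF²) Gʰᵢⱼₖ = 0`: this is a symmetric cubic form that
kills `y`. -/
theorem normSq_mul_berwaldCurv_eq_zero (h : IsLocalFinsler U F) (hz : z ∈ U)
    (hJ : landsbergScalar F z = 0) (i j k : Fin 2) :
    berwaldCurv F 0 i j k z * dy 0 (normSq F) z +
      berwaldCurv F 1 i j k z * dy 1 (normSq F) z = 0 := by
  rw [h.landsbergScalar_eq hz, neg_eq_zero] at hJ
  have hs : sig F z ≠ 0 := left_ne_zero_of_mul (sig_mul_metricDet_pos (h.det_ne z hz)).ne'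
  refine cubic_eq_zero (y := fun i => z.2 i) (m := fun i => mUp F i z) (T := fun i j k =>
    berwaldCurv F 0 i j k z * dy 0 (normSq F) z + berwaldCurv F 1 i j k z * dy 1 (normSq F) z)
    (h.snd_wedge_mUp_ne_zero hz) (fun i j k => ?_) (fun i j k => ?_) (fun i j => ?_)
    ((mul_eq_zero.1 hJ).resolve_left
      (div_ne_zero (mul_ne_zero hs (h.ne_zero hz)) (by norm_num))) i j k
  · simp only [h.berwaldCurv_comm₁₂ hz _ i j k]
  · simp only [h.berwaldCurv_comm₁₃ hz _ i j k]
  · linear_combination dy 0 (normSq F) z * h.berwaldCurv_mul_snd hz 0 i j +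
      dy 1 (normSq F) z * h.berwaldCurv_mul_snd hz 1 i j

/-- On a Landsberg domain, a main scalar that does not depend on the direction is locally
constant: `0 = ∂̇ₖ(S I) = S(∂̇ₖI) + ∂ₖI - 2 Gʲₖ ∂̇ⱼI = ∂ₖI`. -/
theorem dx_mainScalar_eq_zero (h : IsLocalFinsler U F)
    (hJ : ∀ w ∈ U, landsbergScalar F w = 0) (hI : ∀ w ∈ U, ∀ i, dy i (mainScalar F) w = 0)
    (hz : z ∈ U) (k : Fin 2) : dx k (mainScalar F) z = 0 := by
  have ho := h.isOpen
  have hM := h.mainScalar_hom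
  have h1 := h.dy_spray hM hz k
  have h2 := HasDirDeriv.unique ho hz hJ ((h.spray_hom hM).dy' ho hz k) (HasDirDeriv.const 0)
  have h3 : spray F (dy k (mainScalar F)) z = 0 := by
    rw [← fderiv_sprayVec]
    exact HasDirDeriv.unique ho hz (fun w hw => hI w hw k) ((hM.dy ho k).dirDeriv ho hz _)
      (HasDirDeriv.const 0)
  rw [h2, h3, hI z hz, hI z hz] at h1
  linarith

/-- A Landsberg metric whose main scalar does not depend on the direction is Berwald. -/
theorem berwaldCurv_eq_zero (h : IsLocalFinsler U F)
    (hJ : ∀ w ∈ U, landsbergScalar F w = 0) (hI : ∀ w ∈ U, ∀ i, dy i (mainScalar F) w = 0)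
    (hz : z ∈ U) (a i j k : Fin 2) : berwaldCurv F a i j k z = 0 := by
  have ho := h.isOpen
  have hL := h.normSq_hom
  have hwedge := h.snd_wedge_mUp_ne_zero hz
  have hP : ∀ w ∈ U, ∀ i j k, berwaldCurv F 0 i j k w * dy 0 (normSq F) w +
      berwaldCurv F 1 i j k w * dy 1 (normSq F) w = 0 := fun w hw =>
    h.normSq_mul_berwaldCurv_eq_zero hw (hJ w hw)
  -- The horizontal derivatives `δₑ` transport the metric, hence the frame; the defect on the
  -- Cartan tensor is a contraction of the Berwald curvature.
  have hT : ∀ e, ∑ m, ∑ k, ∑ l,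
      (berwaldCurv F 0 l e m z * dy k (dy 0 (normSq F)) z +
        berwaldCurv F 1 l e m z * dy k (dy 1 (normSq F)) z +
      (berwaldCurv F 0 k e m z * dy l (dy 0 (normSq F)) z +
        berwaldCurv F 1 k e m z * dy l (dy 1 (normSq F)) z)) *
      mUp F m z * mUp F k z * mUp F l z = 0 := by
    intro e
    have hδ : fderiv ℝ (mainScalar F) z (hderivVec F e z) = 0 := by
      rw [fderiv_hderivVec, hderiv_eq, h.dx_mainScalar_eq_zero hJ hI hz, hI z hz, hI z hz]
      ring
    rw [h.fderiv_mainScalar hz (v := hderivVec F e z) (N := fun j i => berwaldConn F j i e z)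
      (T := fun m k l => berwaldCurv F 0 l e m z * dy k (dy 0 (normSq F)) z +
        berwaldCurv F 1 l e m z * dy k (dy 1 (normSq F)) z +
      (berwaldCurv F 0 k e m z * dy l (dy 0 (normSq F)) z +
        berwaldCurv F 1 k e m z * dy l (dy 1 (normSq F)) z))] at hδ
    · have hs : sig F z ≠ 0 := left_ne_zero_of_mul (sig_mul_metricDet_pos (h.det_ne z hz)).ne'
      exact (mul_eq_zero.1 hδ).resolve_left
        (div_ne_zero (mul_ne_zero hs (h.ne_zero hz)) (by norm_num))
    · rw [fderiv_hderivVec, hderiv_eq, h.dx_normSq hz]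
      ring
    · intro i
      rw [fderiv_hderivVec, hderiv_eq, h.dx_dy_normSq hz, hL.dy_dy_comm ho hz 0 i,
        hL.dy_dy_comm ho hz 1 i]
      ring
    · intro k l
      rw [fderiv_hderivVec, hderiv_eq, h.dx_dy_dy_normSq hz, hP z hz]
      have c : ∀ j, dy j (dy k (dy l (normSq F))) z = dy k (dy l (dy j (normSq F))) z := fun j => by
        rw [(h.normSq_dy_hom l).dy_dy_comm ho hz j k, hL.dy_dy_dy_comm ho hz k j l]
      rw [c, c]
      ring
    · intro m k l
      have := HasDirDeriv.unique ho hz (fun w hw => by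
          rw [h.dx_dy_dy_normSq hw e l k, hP w hw l e k, zero_add])
        (((h.normSq_dy_dy_hom k l).dx ho e).dy' ho hz m)
        ((((((h.berwaldConn_hom 0 l e).dy' ho hz m).mul
              ((h.normSq_dy_dy_hom k 0).dy' ho hz m)).add
            (((h.berwaldConn_hom 1 l e).dy' ho hz m).mul
              ((h.normSq_dy_dy_hom k 1).dy' ho hz m))).add
          ((((h.berwaldConn_hom 0 k e).dy' ho hz m).mul
              ((h.normSq_dy_dy_hom l 0).dy' ho hz m)).add
            (((h.berwaldConn_hom 1 k e).dy' ho hz m).mul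
              ((h.normSq_dy_dy_hom l 1).dy' ho hz m)))).add
          ((((h.barthel_hom 0 e).dy' ho hz m).mul
              (((h.normSq_dy_dy_hom l 0).dy ho k).dy' ho hz m)).add
            (((h.barthel_hom 1 e).dy' ho hz m).mul
              (((h.normSq_dy_dy_hom l 1).dy ho k).dy' ho hz m))))
      have c4 : ∀ j, dy j (dy m (dy k (dy l (normSq F)))) z =
          dy m (dy k (dy l (dy j (normSq F)))) z := fun j => by
        have he : EqOn (dy j (dy k (dy l (normSq F)))) (dy k (dy l (dy j (normSq F)))) U :=
          fun w hw => by
            rw [(h.normSq_dy_hom l).dy_dy_comm ho hw j k, hL.dy_dy_dy_comm ho hw k j l]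
        rw [(h.normSq_dy_dy_hom k l).dy_dy_comm ho hz j m]
        exact HasDirDeriv.unique ho hz he (((h.normSq_dy_dy_hom k l).dy ho j).dy' ho hz m)
          (((h.normSq_dy_dy_hom l j).dy ho k).dy' ho hz m)
      have c3 : ∀ j, dy k (dy l (dy j (normSq F))) z = dy l (dy k (dy j (normSq F))) z := fun j =>
        (h.normSq_dy_hom j).dy_dy_comm ho hz k l
      rw [fderiv_hderivVec, hderiv_eq, ← (h.normSq_dy_dy_hom k l).dy_dx_comm ho hz m e, this, c4,
        c4, c3, c3]
      unfold berwaldCurv berwaldConn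
      ring
  have hW : ∀ e b, ∑ k, ∑ p, berwaldCurv F b k e p z * mUp F k z * mUp F p z = 0 := by
    intro e
    have hL0 := (h.normSq_dy_hom 0).euler hz
    have hL1 := (h.normSq_dy_hom 1).euler hz
    obtain ⟨W, hW⟩ : ∃ W : Fin 2 → ℝ, ∀ b, W b =
        ∑ k, ∑ p, berwaldCurv F b k e p z * mUp F k z * mUp F p z := ⟨_, fun _ => rfl⟩
    have hWL : W 0 * dy 0 (normSq F) z + W 1 * dy 1 (normSq F) z = 0 := by
      simp only [hW, Fin.sum_univ_two]
      linear_combination mUp F 0 z * mUp F 0 z * hP z hz 0 e 0 +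
        mUp F 0 z * mUp F 1 z * (hP z hz 0 e 1 + hP z hz 1 e 0) +
        mUp F 1 z * mUp F 1 z * hP z hz 1 e 1
    have hWm : mUp F 0 z * (dy 0 (dy 0 (normSq F)) z * W 0 + dy 0 (dy 1 (normSq F)) z * W 1) +
        mUp F 1 z * (dy 1 (dy 0 (normSq F)) z * W 0 + dy 1 (dy 1 (normSq F)) z * W 1) = 0 := by
      have := hT e
      simp only [hW, Fin.sum_univ_two] at this ⊢
      linear_combination (1 / 2) * this
    have ht := eq_zero_of_contract_eq_zero (y := fun i => z.2 i) (m := fun i => mUp F i z)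
      (t := fun l => dy l (dy 0 (normSq F)) z * W 0 + dy l (dy 1 (normSq F)) z * W 1) hwedge (by
        linear_combination W 0 * hL0 + W 1 * hL1 + hWL) hWm
    have h0 := ht 0
    have h1 := ht 1
    have hd := h.det_ne z hz
    rw [metricDet_eq] at hd
    simp only [← hW]
    rw [Fin.forall_fin_two]
    constructor <;> apply mul_left_cancel₀ hd
    · linear_combination (1 / 4) * dy 1 (dy 1 (normSq F)) z * h0 -
        (1 / 4) * dy 0 (dy 1 (normSq F)) z * h1
    · linear_combination (1 / 4) * dy 0 (dy 0 (normSq F)) z * h1 -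
        (1 / 4) * dy 1 (dy 0 (normSq F)) z * h0
  refine cubic_eq_zero (y := fun i => z.2 i) (m := fun i => mUp F i z)
    (T := fun i j k => berwaldCurv F a i j k z) hwedge
    (fun i j k => h.berwaldCurv_comm₁₂ hz a i j k) (fun i j k => h.berwaldCurv_comm₁₃ hz a i j k)
    (fun i j => h.berwaldCurv_mul_snd hz a i j) ?_ i j k
  have h0 := hW 0 a
  have h1 := hW 1 a
  simp only [Fin.sum_univ_two] at h0 h1 ⊢
  linear_combination mUp F 0 z * h0 + mUp F 1 z * h1

end IsLocalFinsler

/-! ### Anisotropic conformal changes -/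

/-- The Gram determinant of `gᵢⱼ = f hᵢⱼ + fᵢ fⱼ` on `y, m`, when `fᵢ yⁱ = f` and `hᵢⱼ yʲ = 0`. -/
theorem gram_det {y0 y1 m0 m1 f f0 f1 h00 h01 h11 : ℝ} (e : y0 * f0 + y1 * f1 = f)
    (a0 : y0 * h00 + y1 * h01 = 0) (a1 : y0 * h01 + y1 * h11 = 0) :
    ((f * h00 + f0 * f0) * (f * h11 + f1 * f1) - (f * h01 + f0 * f1) * (f * h01 + f0 * f1)) *
      (y0 * m1 - y1 * m0) ^ 2 =
      f ^ 3 * (h00 * m0 * m0 + 2 * (h01 * m0 * m1) + h11 * m1 * m1) := by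
  have g1 : (f * h00 + f0 * f0) * y0 * y0 + 2 * ((f * h01 + f0 * f1) * y0 * y1) +
      (f * h11 + f1 * f1) * y1 * y1 = f ^ 2 := by
    linear_combination f * y0 * a0 + f * y1 * a1 + (y0 * f0 + y1 * f1 + f) * e
  have g2 : (f * h00 + f0 * f0) * y0 * m0 + (f * h01 + f0 * f1) * (y0 * m1 + y1 * m0) +
      (f * h11 + f1 * f1) * y1 * m1 = f * (f0 * m0 + f1 * m1) := by
    linear_combination f * m0 * a0 + f * m1 * a1 + (f0 * m0 + f1 * m1) * e
  have g3 : ((f * h00 + f0 * f0) * (f * h11 + f1 * f1) -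
      (f * h01 + f0 * f1) * (f * h01 + f0 * f1)) * (y0 * m1 - y1 * m0) ^ 2 =
      ((f * h00 + f0 * f0) * y0 * y0 + 2 * ((f * h01 + f0 * f1) * y0 * y1) +
        (f * h11 + f1 * f1) * y1 * y1) *
      ((f * h00 + f0 * f0) * m0 * m0 + 2 * ((f * h01 + f0 * f1) * m0 * m1) +
        (f * h11 + f1 * f1) * m1 * m1) -
      ((f * h00 + f0 * f0) * y0 * m0 + (f * h01 + f0 * f1) * (y0 * m1 + y1 * m0) +
        (f * h11 + f1 * f1) * y1 * m1) ^ 2 := by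
    ring
  rw [g3, g1, g2]
  ring

section

variable {U : Set (Plane × Plane)} {F φ : Plane × Plane → ℝ} {z : Plane × Plane}

/-- The Gram determinant of `½ ∂̇ᵢ∂̇ⱼ f²` on `y, m`, for `f` homogeneous of degree `1`. -/
theorem metricDet_mul_wedge_sq (hU : IsOpen U) (hf : IsHom U 1 F) (hz : z ∈ U) (m : Fin 2 → ℝ) :
    metricDet F z * (z.2 0 * m 1 - z.2 1 * m 0) ^ 2 =
      F z ^ 3 * ∑ i, ∑ j, dy i (dy j F) z * m i * m j := by
  have a0 := (hf.dy hU 0).euler hz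
  have a1 := (hf.dy hU 1).euler hz
  have hc := hf.dy_dy_comm hU hz 0 1
  have e := hf.euler hz
  have hg := gram_det (m0 := m 0) (m1 := m 1) (h00 := dy 0 (dy 0 F) z) (h01 := dy 0 (dy 1 F) z)
    (h11 := dy 1 (dy 1 F) z) (e.trans (one_mul _)) (by rw [hc]; linear_combination a0)
    (by linear_combination a1)
  simp only [metricDet_eq, hf.dy_dy_sq hU hz, Fin.sum_univ_two, ← hc]
  linear_combination hg

/-- `F (∂̇ᵢ∂̇ⱼF) mⁱ mʲ = ε`. -/
theorem IsLocalFinsler.hessian_mUp (h : IsLocalFinsler U F) (hz : z ∈ U) :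
    F z * ∑ i, ∑ j, dy i (dy j F) z * mUp F i z * mUp F j z = sig F z := by
  have h1 := metricDet_mul_wedge_sq h.isOpen h.hom hz fun i => mUp F i z
  have h2 := frameScale_sq_mul (h.det_ne z hz)
  rw [h.snd_wedge_mUp hz] at h1
  apply mul_left_cancel₀ (pow_ne_zero 2 (h.ne_zero hz))
  linear_combination (-1) * h1 + F z ^ 2 * h2

theorem dy_mul_mUp (F : Plane × Plane → ℝ) (z : Plane × Plane) :
    dy 0 F z * mUp F 0 z + dy 1 F z * mUp F 1 z = 0 := by
  rw [mUp_zero, mUp_one]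
  ring

/-- The spray equation for `F` itself: `S(F) = 0` and `S(∂̇ₗF) = ∂ₗF`. -/
theorem IsLocalFinsler.spray_dy (h : IsLocalFinsler U F) (hz : z ∈ U) (l : Fin 2) :
    spray F F z = 0 ∧ spray F (dy l F) z = dx l F z := by
  have ho := h.isOpen
  have hF := h.ne_zero hz
  have e0 : spray F F z = 0 := by
    have := (h.hom.dirDeriv ho hz (sprayVec F z)).sq.2
    rw [fderiv_sprayVec, fderiv_sprayVec, h.spray_normSq hz] at this
    simpa [hF] using this.symm
  refine ⟨e0, ?_⟩
  have := HasDirDeriv.unique ho hz (fun w hw => h.hom.dy_sq ho hw l)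
    ((h.normSq_dy_hom l).dirDeriv ho hz (sprayVec F z))
    (((h.hom.dirDeriv ho hz _).const_mul 2).mul ((h.hom.dy ho l).dirDeriv ho hz _))
  rw [fderiv_sprayVec, fderiv_sprayVec, fderiv_sprayVec, e0, h.spray_dy_normSq hz] at this
  have h2 : dx l (normSq F) z = _ := (h.hom.dx' ho hz l).sq.2
  rw [h2] at this
  apply mul_left_cancel₀ hF
  linear_combination (-1 / 2) * this

/-- The metric `e^φ F` in coordinates. -/
noncomputable def conformal (F φ : Plane × Plane → ℝ) : Plane × Plane → ℝ :=
  fun w => Real.exp (φ w) * F w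

theorem conformal_hom (hU : IsOpen U) (hF : IsHom U 1 F) (hφ : IsHom U 0 φ) :
    IsHom U 1 (conformal F φ) :=
  ((hφ.exp hU).mul hU hF).cast (by norm_num)

theorem dy_conformal (hU : IsOpen U) (hF : IsHom U 1 F) (hφ : IsHom U 0 φ) (hz : z ∈ U)
    (l : Fin 2) :
    dy l (conformal F φ) z = Real.exp (φ z) * (F z * dy l φ z + dy l F z) := by
  have : dy l (conformal F φ) z = _ := ((hφ.dy' hU hz l).exp.mul (hF.dy' hU hz l)).2
  rw [this]
  ring

theorem fderiv_dy_conformal (hU : IsOpen U) (hF : IsHom U 1 F) (hφ : IsHom U 0 φ) (hz : z ∈ U)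
    (l : Fin 2) (v : Plane × Plane) :
    fderiv ℝ (dy l (conformal F φ)) z v = Real.exp (φ z) *
      (fderiv ℝ φ z v * (F z * dy l φ z + dy l F z) + fderiv ℝ F z v * dy l φ z +
        F z * fderiv ℝ (dy l φ) z v + fderiv ℝ (dy l F) z v) := by
  have := HasDirDeriv.unique hU hz (fun w hw => dy_conformal hU hF hφ hw l)
    (((conformal_hom hU hF hφ).dy hU l).dirDeriv hU hz v)
    ((hφ.dirDeriv hU hz v).exp.mul (((hF.dirDeriv hU hz v).mul
      ((hφ.dy hU l).dirDeriv hU hz v)).add ((hF.dy hU l).dirDeriv hU hz v)))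
  rw [this]
  ring

theorem dy_dy_conformal (hU : IsOpen U) (hF : IsHom U 1 F) (hφ : IsHom U 0 φ) (hz : z ∈ U)
    (i l : Fin 2) :
    dy i (dy l (conformal F φ)) z = Real.exp (φ z) *
      (dy i φ z * (F z * dy l φ z + dy l F z) + dy i F z * dy l φ z +
        F z * dy i (dy l φ) z + dy i (dy l F) z) :=
  fderiv_dy_conformal hU hF hφ hz l (0, EuclideanSpace.single i 1)

/-- The Hessian of `e^φ F` in the direction `m`. -/
theorem hessian_conformal (h : IsLocalFinsler U F) (hφ : IsHom U 0 φ) (hz : z ∈ U) :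
    F z * ∑ i, ∑ j, dy i (dy j (conformal F φ)) z * mUp F i z * mUp F j z =
      Real.exp (φ z) * (F z ^ 2 * (∑ i, ∑ j, (dy i (dy j φ) z + dy i φ z * dy j φ z) *
        mUp F i z * mUp F j z) + sig F z) := by
  have h1 := h.hessian_mUp hz
  have h2 := dy_mul_mUp F z
  simp only [dy_dy_conformal h.isOpen h.hom hφ hz, Fin.sum_univ_two] at h1 ⊢
  linear_combination Real.exp (φ z) * h1 + 2 * Real.exp (φ z) * F z *
    (dy 0 φ z * mUp F 0 z + dy 1 φ z * mUp F 1 z) * h2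

/-- The nondegeneracy condition makes `e^φ F` a pseudo-Finsler metric, because
`det ḡ (y ∧ m)² = F̄³ (∂̇ᵢ∂̇ⱼF̄) mⁱ mʲ`. -/
theorem isLocalFinsler_conformal (h : IsLocalFinsler U F) (hφ : IsHom U 0 φ)
    (hn : ∀ z ∈ U, F z ^ 2 * (∑ i, ∑ j, (dy i (dy j φ) z + dy i φ z * dy j φ z) *
        mUp F i z * mUp F j z) + sig F z ≠ 0) : IsLocalFinsler U (conformal F φ) := by
  have ho := h.isOpen
  refine ⟨ho, conformal_hom ho h.hom hφ, fun z hz h0 => ?_⟩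
  have h1 := metricDet_mul_wedge_sq ho (conformal_hom ho h.hom hφ) hz fun i => mUp F i z
  rw [h0, zero_mul] at h1
  have h2 := hessian_conformal h hφ hz
  have h3 : conformal F φ z ≠ 0 := mul_ne_zero (Real.exp_ne_zero _) (h.ne_zero hz)
  rw [(mul_eq_zero.1 h1.symm).resolve_left (pow_ne_zero 3 h3), mul_zero] at h2
  exact mul_ne_zero (Real.exp_ne_zero _) (hn z hz) h2.symm

/-- The expression `q` in terms of the spray: `q = ε mˡ (S(φ) ∂̇ₗφ + S(∂̇ₗφ) - ∂ₗφ)`. -/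
theorem qExpr_eq (h : IsLocalFinsler U F) (hφ : IsHom U 0 φ) (hz : z ∈ U) :
    qExpr F φ z = sig F z * ∑ l, mUp F l z *
      (spray F φ z * dy l φ z + spray F (dy l φ) z - dx l φ z) := by
  have ho := h.isOpen
  have hF := h.ne_zero hz
  have e1 : EqOn (hder1 F φ) (fun w => spray F φ w * (F w)⁻¹) U := fun w hw => by
    simp only [hder1, Fin.sum_univ_two, ellUp, div_eq_mul_inv]
    rw [h.spray_eq_hderiv hw]
    ring
  have hS := h.spray_hom hφ
  have hH := (hS.mul ho (h.hom.inv ho fun w hw => h.ne_zero hw)).congr ho e1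
  have e2 : ∀ l, dy l (hder1 F φ) z = _ := fun l =>
    HasDirDeriv.unique ho hz e1 (hH.dy' ho hz l)
      ((hS.dy' ho hz l).mul ((h.hom.dy' ho hz l).inv hF))
  have h2 := dy_mul_mUp F z
  simp only [qExpr, vder2, hder2, Fin.sum_univ_two, e1 hz, e2, hderiv_eq, h.dy_spray hφ hz]
  field_simp
  linear_combination (-1) * sig F z * spray F φ z * h2

/-- `q` is a nonzero multiple of `(Ḡⁱ - Gⁱ) (∂̇ᵢ∂̇ₗF̄) mˡ`: this is the spray equation for `F̄`
in the direction `m`. -/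
theorem sub_sprayCoeff_hessian (h : IsLocalFinsler U F) (hφ : IsHom U 0 φ)
    (h' : IsLocalFinsler U (conformal F φ)) (hz : z ∈ U) :
    2 * ∑ i, ∑ l, (sprayCoeff (conformal F φ) i z - sprayCoeff F i z) *
      dy i (dy l (conformal F φ)) z * mUp F l z = Real.exp (φ z) * F z * sig F z * qExpr F φ z := by
  have ho := h.isOpen
  have hs := sig_mul_self (h.det_ne z hz)
  have e : ∀ l, spray F (dy l (conformal F φ)) z - dx l (conformal F φ) z = Real.exp (φ z) *
      (F z * (spray F φ z * dy l φ z + spray F (dy l φ) z - dx l φ z) +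
        spray F φ z * dy l F z) := fun l => by
    have e1 : dx l (conformal F φ) z = _ := ((hφ.dx' ho hz l).exp.mul (h.hom.dx' ho hz l)).2
    rw [← fderiv_sprayVec, fderiv_dy_conformal ho h.hom hφ hz, fderiv_sprayVec, fderiv_sprayVec,
      fderiv_sprayVec, fderiv_sprayVec, (h.spray_dy hz l).1, (h.spray_dy hz l).2, e1]
    ring
  have d := fun l => (h'.spray_dy hz l).2
  have e0 := e 0
  have e1 := e 1
  have d0 := d 0
  have d1 := d 1
  rw [spray_eq] at d0 d1 e0 e1
  have h2 := dy_mul_mUp F z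
  rw [qExpr_eq h hφ hz]
  simp only [Fin.sum_univ_two]
  linear_combination mUp F 0 z * (e0 - d0) + mUp F 1 z * (e1 - d1) +
    Real.exp (φ z) * spray F φ z * h2 - Real.exp (φ z) * F z *
    (mUp F 0 z * (spray F φ z * dy 0 φ z + spray F (dy 0 φ) z - dx 0 φ z) +
      mUp F 1 z * (spray F φ z * dy 1 φ z + spray F (dy 1 φ) z - dx 1 φ z)) * hs

/-- `y ∧ (Ḡ - G)`, which vanishes exactly where the two sprays differ by a multiple of `y`. -/
noncomputable def sprayWedge (F F' : Plane × Plane → ℝ) (z : Plane × Plane) : ℝ :=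
  z.2 0 * (sprayCoeff F' 1 z - sprayCoeff F 1 z) - z.2 1 * (sprayCoeff F' 0 z - sprayCoeff F 0 z)

theorem sprayQ_eq_zero_iff (h : IsLocalFinsler U F) (F' : Plane × Plane → ℝ) (hz : z ∈ U) :
    sprayQ F F' z = 0 ↔ sprayWedge F F' z = 0 := by
  have hF := h.ne_zero hz
  have hp := sig_mul_metricDet_pos (h.det_ne z hz)
  have hs : sig F z ≠ 0 := left_ne_zero_of_mul hp.ne'
  have hr := (Real.sqrt_pos.2 hp).ne'
  have e : sprayQ F F' z =
      sig F z * √(sig F z * metricDet F z) * (F z)⁻¹ * sprayWedge F F' z := by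
    simp [sprayQ, sprayWedge, mLow, ellUp, div_eq_mul_inv]
    ring
  rw [e, mul_eq_zero]
  exact or_iff_right (mul_ne_zero (mul_ne_zero hs hr) (inv_ne_zero hF))

theorem qExpr_eq_zero_iff (h : IsLocalFinsler U F) (hφ : IsHom U 0 φ)
    (hn : ∀ z ∈ U, F z ^ 2 * (∑ i, ∑ j, (dy i (dy j φ) z + dy i φ z * dy j φ z) *
        mUp F i z * mUp F j z) + sig F z ≠ 0) (hz : z ∈ U) :
    qExpr F φ z = 0 ↔ sprayWedge F (conformal F φ) z = 0 := by
  have ho := h.isOpen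
  have h' := isLocalFinsler_conformal h hφ hn
  have hF := h.ne_zero hz
  have hs : sig F z ≠ 0 := left_ne_zero_of_mul (sig_mul_metricDet_pos (h.det_ne z hz)).ne'
  have h1 := sub_sprayCoeff_hessian h hφ h' hz
  have h2 := hessian_conformal h hφ hz
  have hw := h.snd_wedge_mUp_ne_zero hz
  have a0 := (h'.hom.dy ho 0).euler hz
  have a1 := (h'.hom.dy ho 1).euler hz
  -- `∂̇ᵢ∂̇ₗF̄` kills `y`, so only the component of `Ḡ - G` along `m` contributes.
  have key : (z.2 0 * mUp F 1 z - z.2 1 * mUp F 0 z) * ∑ i, ∑ l,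
      (sprayCoeff (conformal F φ) i z - sprayCoeff F i z) *
        dy i (dy l (conformal F φ)) z * mUp F l z =
      sprayWedge F (conformal F φ) z *
        ∑ i, ∑ j, dy i (dy j (conformal F φ)) z * mUp F i z * mUp F j z := by
    simp only [Fin.sum_univ_two, sprayWedge]
    linear_combination ((sprayCoeff (conformal F φ) 0 z - sprayCoeff F 0 z) * mUp F 1 z -
      (sprayCoeff (conformal F φ) 1 z - sprayCoeff F 1 z) * mUp F 0 z) *
      (mUp F 0 z * a0 + mUp F 1 z * a1)
  have hH : ∑ i, ∑ j, dy i (dy j (conformal F φ)) z * mUp F i z * mUp F j z ≠ 0 := by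
    intro h0
    rw [h0, mul_zero] at h2
    exact mul_ne_zero (Real.exp_ne_zero _) (hn z hz) h2.symm
  constructor
  · intro hq
    rw [hq, mul_zero] at h1
    rw [(mul_eq_zero.1 h1).resolve_left two_ne_zero, mul_zero] at key
    exact (mul_eq_zero.1 key.symm).resolve_right hH
  · intro hq
    rw [hq, zero_mul] at key
    rw [(mul_eq_zero.1 key).resolve_left hw, mul_zero] at h1
    exact (mul_eq_zero.1 h1.symm).resolve_left
      (mul_ne_zero (mul_ne_zero (Real.exp_ne_zero _) hF) hs)

end

/-! ### Two metrics, the main scalar of one being a first integral of the spray of the other -/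

section

variable {U : Set (Plane × Plane)} {F F' : Plane × Plane → ℝ} {z : Plane × Plane}

/-- If the main scalar of `F'` is a first integral of the spray of `F`, the Landsberg scalar of `F'`
comes from the difference of the two sprays alone. -/
theorem landsbergScalar_eq_of_firstIntegral (hI : spray F (mainScalar F') z = 0) :
    landsbergScalar F' z = -2 * ((sprayCoeff F' 0 z - sprayCoeff F 0 z) * dy 0 (mainScalar F') z +
      (sprayCoeff F' 1 z - sprayCoeff F 1 z) * dy 1 (mainScalar F') z) := by
  unfold landsbergScalar
  rw [spray_eq] at hI ⊢
  linear_combination hI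

theorem landsbergScalar_eq_zero_of_sprayWedge (h' : IsLocalFinsler U F') (hz : z ∈ U)
    (hI : spray F (mainScalar F') z = 0) (hw : sprayWedge F F' z = 0) :
    landsbergScalar F' z = 0 := by
  have he := h'.mainScalar_hom.euler hz
  rw [zero_mul] at he
  rw [landsbergScalar_eq_of_firstIntegral hI]
  unfold sprayWedge at hw
  have hy := h'.snd_ne_zero hz
  rw [not_and_or] at hy
  rcases hy with hy | hy <;> apply mul_left_cancel₀ hy
  · linear_combination -2 * (sprayCoeff F' 0 z - sprayCoeff F 0 z) * he -
      2 * dy 1 (mainScalar F') z * hw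
  · linear_combination -2 * (sprayCoeff F' 1 z - sprayCoeff F 1 z) * he +
      2 * dy 0 (mainScalar F') z * hw

theorem IsLocalFinsler.landsbergScalar_eq_zero_of_berwaldCurv (h : IsLocalFinsler U F)
    (hz : z ∈ U) (hB : ∀ a i j k, berwaldCurv F a i j k z = 0) : landsbergScalar F z = 0 := by
  rw [h.landsbergScalar_eq hz]
  simp [hB]

/-- Where a Landsberg metric `F'` has a spray that differs from that of `F` by more than a multiple
of `y`, its main scalar cannot depend on the direction, and the Berwald curvature vanishes. -/
theorem berwaldCurv_eq_zero_of_sprayWedge_ne_zero (h : IsLocalFinsler U F)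
    (h' : IsLocalFinsler U F') (hI : ∀ w ∈ U, spray F (mainScalar F') w = 0)
    (hJ : ∀ w ∈ U, landsbergScalar F' w = 0) (hz : z ∈ U) (hw : sprayWedge F F' z ≠ 0)
    (a i j k : Fin 2) : berwaldCurv F' a i j k z = 0 := by
  have ho := h.isOpen
  have hd : ∀ i, IsHom U 2 (fun w => sprayCoeff F' i w - sprayCoeff F i w) := fun i =>
    (h'.sprayCoeff_hom i).sub ho (h.sprayCoeff_hom i)
  have hcont : ContinuousOn (sprayWedge F F') U :=
    (((IsHom.coord 0).mul ho (hd 1)).sub ho ((IsHom.coord 1).mul ho (hd 0))).smooth.continuousOn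
  have hV : IsOpen (U ∩ sprayWedge F F' ⁻¹' {0}ᶜ) :=
    hcont.isOpen_inter_preimage ho isOpen_compl_singleton
  refine (h'.mono hV inter_subset_left).berwaldCurv_eq_zero (fun w hw => hJ w hw.1)
    (fun w hw => ?_) ⟨hz, hw⟩ a i j k
  refine eq_zero_of_contract_eq_zero (y := fun i => w.2 i)
    (m := fun i => sprayCoeff F' i w - sprayCoeff F i w) (t := fun i => dy i (mainScalar F') w)
    hw.2 ?_ ?_
  · have := h'.mainScalar_hom.euler hw.1
    rwa [zero_mul] at this
  · have := landsbergScalar_eq_of_firstIntegral (hI w hw.1)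
    rw [hJ w hw.1] at this
    linear_combination (1 / 2) * this

end

/-! ### Passage to natural coordinates -/

section Global

variable {M : Type*} [TopologicalSpace M] [ChartedSpace Plane M] [IsManifold (𝓡 2) ∞ M]
  {A : Set (TangentBundle (𝓡 2) M)} {F φ f : TangentBundle (𝓡 2) M → ℝ}

theorem IsSmoothHomogeneous.isHom_loc {r : ℕ} (hA : IsOpen A) (hf : IsSmoothHomogeneous A r f)
    (p : M) : IsHom (locDom A p) r (loc p f) :=
  IsHom.of_homogeneous (isOpen_locDom hA p) (contDiffOn_loc hf.smooth p) r
    fun _ hz _ hc => loc_smul hf p hz hc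

theorem IsConicPseudoFinsler.isLocalFinsler_loc (hF : IsConicPseudoFinsler A F) (p : M) :
    IsLocalFinsler (locDom A p) (loc p F) :=
  ⟨isOpen_locDom hF.conic.isOpen p,
    (hF.smoothHomogeneous.isHom_loc hF.conic.isOpen p).cast Nat.cast_one,
    hF.nondegenerate p⟩

theorem IsAnisotropicConformalFactor.isHom_loc (hF : IsConicPseudoFinsler A F)
    (hφ : IsAnisotropicConformalFactor A F φ) (p : M) : IsHom (locDom A p) 0 (loc p φ) :=
  (hφ.smoothHomogeneous.isHom_loc hF.conic.isOpen p).cast Nat.cast_zero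

theorem isLocalFinsler_loc_anisotropicChange (hF : IsConicPseudoFinsler A F)
    (hφ : IsAnisotropicConformalFactor A F φ) (p : M) :
    IsLocalFinsler (locDom A p) (loc p (anisotropicChange F φ)) :=
  isLocalFinsler_conformal (hF.isLocalFinsler_loc p) (hφ.isHom_loc hF p) (hφ.nondegenerate p)

theorem qVanishesAt_iff (hF : IsConicPseudoFinsler A F)
    (hφ : IsAnisotropicConformalFactor A F φ) (p : M) {z : Plane × Plane} (hz : z ∈ locDom A p) :
    QVanishesAt F φ p z ↔ sprayWedge (loc p F) (loc p (anisotropicChange F φ)) z = 0 :=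
  qExpr_eq_zero_iff (hF.isLocalFinsler_loc p) (hφ.isHom_loc hF p) (hφ.nondegenerate p) hz

theorem isLandsberg_anisotropicChange_iff (hF : IsConicPseudoFinsler A F)
    (hφ : IsAnisotropicConformalFactor A F φ)
    (hI : MainScalarIsFirstIntegral A F (anisotropicChange F φ)) :
    IsLandsberg A (anisotropicChange F φ) ↔ ∀ p : M, ∀ z ∈ locDom A p,
      QVanishesAt F φ p z ∨ IsBerwaldAt (anisotropicChange F φ) p z := by
  constructor
  · intro hJ p z hz
    refine or_iff_not_imp_left.2 fun hq a i j k => ?_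
    rw [qVanishesAt_iff hF hφ p hz] at hq
    exact berwaldCurv_eq_zero_of_sprayWedge_ne_zero (hF.isLocalFinsler_loc p)
      (isLocalFinsler_loc_anisotropicChange hF hφ p) (hI p) (hJ p) hz hq a i j k
  · intro h p z hz
    have h' := isLocalFinsler_loc_anisotropicChange hF hφ p
    rcases h p z hz with hq | hB
    · exact landsbergScalar_eq_zero_of_sprayWedge h' hz (hI p z hz)
        ((qVanishesAt_iff hF hφ p hz).1 hq)
    · exact h'.landsbergScalar_eq_zero_of_berwaldCurv hz hB

/-- The Berwald curvature is continuous, so it vanishes everywhere once it vanishes off a set with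
empty interior. -/
theorem isBerwald_of_qVanishesOnNoOpenSet (hF : IsConicPseudoFinsler A F)
    (hφ : IsAnisotropicConformalFactor A F φ) (hno : QVanishesOnNoOpenSet A F φ)
    (h : ∀ p : M, ∀ z ∈ locDom A p,
      QVanishesAt F φ p z ∨ IsBerwaldAt (anisotropicChange F φ) p z) :
    IsBerwald A (anisotropicChange F φ) := by
  intro p z hz a i j k
  by_contra hne
  have h' := isLocalFinsler_loc_anisotropicChange hF hφ p
  have hV : IsOpen (locDom A p ∩
      berwaldCurv (loc p (anisotropicChange F φ)) a i j k ⁻¹' {0}ᶜ) :=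
    (h'.berwaldCurv_hom a i j k).smooth.continuousOn.isOpen_inter_preimage h'.isOpen
      isOpen_compl_singleton
  have hsub : locDom A p ∩ berwaldCurv (loc p (anisotropicChange F φ)) a i j k ⁻¹' {0}ᶜ ⊆
      {z | z ∈ locDom A p ∧ QVanishesAt F φ p z} := fun w hw =>
    ⟨hw.1, (h p w hw.1).resolve_right fun hB => hw.2 (hB a i j k)⟩
  have : z ∈ interior {z | z ∈ locDom A p ∧ QVanishesAt F φ p z} :=
    interior_maximal hsub hV ⟨hz, hne⟩
  rw [hno p] at this
  exact this

end Global

end FinslerSurface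

theorem mainTheorem8 {M : Type*} [TopologicalSpace M] [ChartedSpace Plane M]
    [IsManifold (𝓡 2) ∞ M] (A : Set (TangentBundle (𝓡 2) M))
    (F φ : TangentBundle (𝓡 2) M → ℝ)
    (hF : IsConicPseudoFinsler A F)
    (hφ : IsAnisotropicConformalFactor A F φ)
    (hI : MainScalarIsFirstIntegral A F (anisotropicChange F φ)) :
    -- the expression in `φ` vanishes exactly where `Q` does
    (∀ p : M, ∀ z ∈ locDom A p,
      (QVanishesAt F φ p z ↔ sprayQ (loc p F) (loc p (anisotropicChange F φ)) z = 0)) ∧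
    -- the equivalence, with the alternative taken at each point
    (IsLandsberg A (anisotropicChange F φ) ↔
      ∀ p : M, ∀ z ∈ locDom A p,
        QVanishesAt F φ p z ∨ IsBerwaldAt (anisotropicChange F φ) p z) ∧
    -- sufficiency of each of the two global alternatives
    ((QVanishes A F φ ∨ IsBerwald A (anisotropicChange F φ)) →
      IsLandsberg A (anisotropicChange F φ)) ∧
    -- the equivalence, with the alternative taken globally
    ((QVanishes A F φ ∨ QVanishesOnNoOpenSet A F φ) →
      (IsLandsberg A (anisotropicChange F φ) ↔
        (QVanishes A F φ ∨ IsBerwald A (anisotropicChange F φ)))) := by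
  have key := isLandsberg_anisotropicChange_iff hF hφ hI
  have suff : (QVanishes A F φ ∨ IsBerwald A (anisotropicChange F φ)) →
      IsLandsberg A (anisotropicChange F φ) := by
    rintro (h | h)
    · exact key.2 fun p z hz => Or.inl (h p z hz)
    · exact key.2 fun p z hz => Or.inr (h p z hz)
  refine ⟨fun p z hz => ?_, key, suff, fun hq => ⟨fun hL => ?_, suff⟩⟩
  · rw [qVanishesAt_iff hF hφ p hz, sprayQ_eq_zero_iff (hF.isLocalFinsler_loc p) _ hz]
  · rcases hq with hq | hno
    · exact Or.inl hq
    · exact Or.inr (isBerwald_of_qVanishesOnNoOpenSet hF hφ hno (key.1 hL))
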